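/- Let $\mathcal K$ be a locally finitely presentable category and let $\mathcal L\subseteq\mathcal K$ be a definable subcategory, i.e. a full subcategory closed in $\mathcal K$ under products, directed colimits and pure subobjects. For a category $\mathcal A$ with products and directed colimits let $\mathcal A^+$ denote the category of functors $\mathcal A\to\mathrm{Set}$ that preserve products and directed colimits, with natural transformations as morphisms. Let $\mathrm{EX}$ denote the 2-category of (essentially) small Barr-exact categories, regular functors (functors preserving finite limits and regular epimorphisms) and natural transformations. Then the functor $Q:\mathcal K^+\to\mathcal L^+$ given by precomposition with the inclusion $\mathcal L\to\mathcal K$ is an epimorphism in $\mathrm{EX}$, in the 2-categorical sense: $\mathcal K^+$ and $\mathcal L^+$ are essentially small exact categories, $Q$ is a regular functor, and for every small exact category $\mathcal B$ and all regular functors $P_1,P_2:\mathcal L^+\to\mathcal B$, every natural transformation $\alpha:P_1\circ Q\Rightarrow P_2\circ Q$ is of the form $\beta Q$ for a unique natural transformation $\beta:P_1\Rightarrow P_2$. In particular, $P_1\circ Q\cong P_2\circ Q$ implies $P_1\cong P_2$. -/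

import Mathlib

open CategoryTheory Limits

universe u w a b v₁ u₁ v₂ u₂

namespace DefinableCat

/-! ### Definable subcategories of locally finitely presentable categories -/

/-- A morphism `f : A ⟶ B` is pure if in every commutative square
`g ≫ f = h ≫ k` with `h : X ⟶ Y` a morphism between finitely presentable objects,
`g` factors through `h`. -/
def IsPure {K : Type w} [Category.{u} K] {A B : K} (f : A ⟶ B) : Prop :=
  ∀ ⦃X Y : K⦄ [IsFinitelyPresentable.{u} X] [IsFinitelyPresentable.{u} Y]
    (h : X ⟶ Y) (g : X ⟶ A) (k : Y ⟶ B), g ≫ f = h ≫ k → ∃ d : Y ⟶ A, h ≫ d = g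

/-- A full subcategory of `K` (given by a property of objects) is definable if it is closed in `K`
under small products, colimits of small directed diagrams, and pure subobjects. -/
structure IsDefinable {K : Type w} [Category.{u} K] (L : ObjectProperty K) : Prop where
  products : ∀ J : Type u, L.IsClosedUnderLimitsOfShape (Discrete J)
  directedColimits : ∀ (J : Type u) [PartialOrder J] [IsDirectedOrder J] [Nonempty J],
    L.IsClosedUnderColimitsOfShape J
  pureSubobjects : ∀ ⦃A B : K⦄ (f : A ⟶ B) [Mono f], IsPure f → L B → L A

/-! ### The category `A⁺` -/

/-- The `Set`-valued functors that preserve small products and directed colimits. -/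
def IsInterpretation (A : Type w) [Category.{u} A] : ObjectProperty (A ⥤ Type u) := fun F =>
  (∀ J : Type u, PreservesLimitsOfShape (Discrete J) F) ∧
  (∀ (J : Type u) [PartialOrder J] [IsDirectedOrder J] [Nonempty J], PreservesColimitsOfShape J F)

/-- `A⁺`: the category of functors `A ⥤ Set` preserving small products and directed colimits, with
all natural transformations between them. -/
abbrev Plus (A : Type w) [Category.{u} A] := (IsInterpretation A).FullSubcategory

/-! ### Small exact categories and regular functors -/

/-- A (Barr-)exact category: a regular category in which every internal equivalence relation is
a kernel pair. -/
structure IsExact (C : Type u₁) [Category.{v₁} C] : Prop where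
  regular : Regular C
  effective : ∀ ⦃R X : C⦄ (p₁ p₂ : R ⟶ X), IsEquivalenceRelation p₁ p₂ →
    ∃ (Y : C) (f : X ⟶ Y), IsKernelPair f p₁ p₂

/-- The objects of `EX`: exact categories that are small, up to equivalence. -/
structure IsSmallExact (C : Type u₁) [Category.{v₁} C] : Prop where
  small : EssentiallySmall.{u} C
  exact : IsExact C

/-- A functor is regular if it preserves finite limits and regular epimorphisms. -/
structure IsRegularFunctor {C : Type u₁} [Category.{v₁} C] {D : Type u₂} [Category.{v₂} D]
    (F : C ⥤ D) : Prop where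
  lex : PreservesFiniteLimits F
  regularEpi : ∀ ⦃X Y : C⦄ (f : X ⟶ Y), IsRegularEpi f → IsRegularEpi (F.map f)

/-- `Q : C ⥤ D` is an epimorphism in the 2-category `EX` of small exact categories, regular functors
and natural transformations: it is a 1-morphism of `EX`, and for every small exact category `B`
precomposition with `Q` is a fully faithful functor `Reg(D, B) ⥤ Reg(C, B)`. In particular,
`Q ⋙ P₁ ≅ Q ⋙ P₂` implies `P₁ ≅ P₂` for regular functors `P₁`, `P₂`. -/
structure IsEpiEX {C : Type u₁} [Category.{v₁} C]
    {D : Type u₂} [Category.{v₂} D] (Q : C ⥤ D) : Prop where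
  source : IsSmallExact.{u} C
  target : IsSmallExact.{u} D
  regular : IsRegularFunctor Q
  epi : ∀ (B : Type a) [Category.{b} B], IsSmallExact.{u} B →
    ∀ P₁ P₂ : D ⥤ B, IsRegularFunctor P₁ → IsRegularFunctor P₂ →
      ∀ α : Q ⋙ P₁ ⟶ Q ⋙ P₂, ∃! β : P₁ ⟶ P₂, Functor.whiskerLeft Q β = α

/-! ### The restriction functor -/

section
variable {K : Type w} [Category.{u} K]

/-- A locally finitely presentable category is complete, being reflective in presheaves on
(a small model of) its finitely presentable objects. -/
theorem hasLimits_of_lfp [IsLocallyFinitelyPresentable.{u} K] : HasLimitsOfSize.{u, u} K := by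
  let P := ObjectProperty.isFinitelyPresentable.{u} K
  have : EssentiallySmall.{u} P.FullSubcategory := inferInstance
  let F : SmallModel.{u} P.FullSubcategory ⥤ K :=
    (equivSmallModel.{u} P.FullSubcategory).inverse ⋙ P.ι
  have : F.IsDense := inferInstance
  let adj := Presheaf.uliftYonedaAdjunction.{u} (uliftYoneda.{u}.leftKanExtension F)
    (uliftYoneda.{u}.leftKanExtensionUnit F)
  let : Reflective (Presheaf.restrictedULiftYoneda.{u} F) := ⟨_, adj⟩
  exact hasLimits_of_reflective (Presheaf.restrictedULiftYoneda.{u} F)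

/-- The inclusion of a definable subcategory preserves products and directed colimits, hence so
does the restriction to it of every functor in `K⁺`. -/
theorem IsDefinable.isInterpretation_restrict [IsLocallyFinitelyPresentable.{u} K]
    {L : ObjectProperty K} (hL : IsDefinable L) {F : K ⥤ Type u} (hF : IsInterpretation K F) :
    IsInterpretation L.FullSubcategory (L.ι ⋙ F) := by
  have := hasLimits_of_lfp (K := K)
  refine ⟨fun J => ?_, fun J _ _ _ => ?_⟩
  · have := hF.1 J
    have := hL.products J
    have : PreservesLimitsOfShape (Discrete J) L.ι := ⟨fun {D} => by
      have := createsLimitFullSubcategoryInclusion D (L.prop_limit _ fun j => (D.obj j).property)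
      infer_instance⟩
    infer_instance
  · have := hF.2 J
    have := hL.directedColimits J
    have : PreservesColimitsOfShape J L.ι := ⟨fun {D} => by
      have := createsColimitFullSubcategoryInclusion D
        (L.prop_colimit _ fun j => (D.obj j).property)
      infer_instance⟩
    infer_instance

/-- The functor `K⁺ ⥤ L⁺` given by precomposition with the inclusion `L ⥤ K`. -/
def restriction [IsLocallyFinitelyPresentable.{u} K] {L : ObjectProperty K} (hL : IsDefinable L) :
    Plus K ⥤ Plus L.FullSubcategory :=
  (IsInterpretation L.FullSubcategory).lift
    ((IsInterpretation K).ι ⋙ (Functor.whiskeringLeft _ _ _).obj L.ι)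
    (fun F => hL.isInterpretation_restrict F.property)

end

end DefinableCat

open Opposite

namespace DefinableCat

/-! ### Closed subsets of bounded cardinality -/

/-! Everything rests on two covering properties of $Q$ (`IsCovering`): each $F\in\mathcal L^+$ is a
regular quotient of some $QX$, and each subobject of $QX$ is covered by the image of a morphism
$Z\to X$ of $\mathcal K^+$. Granted these, a transformation $\alpha:P_1Q\Rightarrow P_2Q$ descends
along the regular epimorphism $P_1(QX\to F)$, since the kernel pair of $QX\to F$ is again covered by
some $QZ$, where naturality of $\alpha$ applies (`IsCovering.existsUnique_whiskerLeft_eq`).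

The covers are restrictions of representables $\mathrm{Hom}(C,-)$ with $C$ finitely presentable.
Some $P\in\mathcal L$ carries a generic $x\in F(P)$, whose images under all $P\to X$ exhaust $F(X)$.
Write $P$ in $\mathcal K$ as a directed colimit of finitely presentable $C_j$. Then $x$ extends to a
transformation $\mathrm{Hom}(C_i,-)|_{\mathcal L}\to F$ for some $i$, and two such extensions agree
after passing to a later index. Both are compactness arguments: morphisms $C_j\to U_j$ with
$U_j\in\mathcal L$ induce a morphism from $P$ to the reduced product $\mathrm{colim}_j\prod_{k\ge
j}U_k$, which lies in $\mathcal L$ and is preserved by $F$, so what holds of $x$ holds eventually in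
the $U_k$.

A set of test objects of $\mathcal L$ suffices for this, by a Löwenheim–Skolem argument: for a
suitable $\kappa$ each object is a $\kappa$-filtered colimit of $\kappa$-presentable pure subobjects
(`exists_pure_presentation`), and these stay in $\mathcal L$. Test objects also give smallness.
Exactness of $\mathcal A^+$ is pointwise: interpretations are closed under finite limits and under
quotients by equivalence relations. -/

theorem exists_closed_superset {α : Type u} {κ : Cardinal.{u}} [Fact κ.IsRegular]
    (hκ : Cardinal.aleph0 < κ) {E : α → Type u} (hE : ∀ a, HasCardinalLT (E a) κ)
    (f : ∀ a, E a → α) (s : α → α → α) (A : Set α) (hA : HasCardinalLT A κ) :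
    ∃ B : Set α, A ⊆ B ∧ HasCardinalLT B κ ∧ (∀ a ∈ B, ∀ e, f a e ∈ B) ∧
      ∀ a ∈ B, ∀ b ∈ B, s a b ∈ B := by
  let step : Set α → Set α := fun X =>
    (X ∪ Set.range (fun p : Σ a : X, E a => f p.1 p.2)) ∪
      Set.range (fun p : X × X => s p.1 p.2)
  let X : ℕ → Set α := fun n => step^[n] A
  have hX : ∀ n, X (n + 1) = step (X n) := fun n => Function.iterate_succ_apply' _ _ _
  have hmono : Monotone X := monotone_nat_of_le_succ fun n => by
    rw [hX]
    exact Set.subset_union_left.trans Set.subset_union_left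
  have hcard : ∀ n, HasCardinalLT (X n) κ := by
    intro n
    induction n with
    | zero => exact hA
    | succ n ih =>
      rw [hX]
      refine hasCardinalLT_union hκ.le (hasCardinalLT_union hκ.le ih ?_) ?_
      · exact (hasCardinalLT_sigma' (fun a : X n => E a) κ ih fun a => hE a).of_surjective _
          Set.rangeFactorization_surjective
      · exact (hasCardinalLT_prod' hκ.le ih ih).of_surjective _
          Set.rangeFactorization_surjective
  refine ⟨⋃ n, X n, Set.subset_iUnion X 0, ?_, ?_, ?_⟩
  · refine hasCardinalLT_iUnion X ?_ hcard
    simpa [HasCardinalLT] using hκ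
  · intro a ha e
    obtain ⟨n, hn⟩ := Set.mem_iUnion.1 ha
    refine Set.mem_iUnion.2 ⟨n + 1, ?_⟩
    rw [hX]
    exact Or.inl (Or.inr ⟨⟨⟨a, hn⟩, e⟩, rfl⟩)
  · intro a ha b hb
    obtain ⟨n, hn⟩ := Set.mem_iUnion.1 ha
    obtain ⟨m, hm⟩ := Set.mem_iUnion.1 hb
    refine Set.mem_iUnion.2 ⟨max n m + 1, ?_⟩
    rw [hX]
    exact Or.inr ⟨⟨⟨a, hmono (le_max_left _ _) hn⟩, ⟨b, hmono (le_max_right _ _) hm⟩⟩, rfl⟩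

/-! ### Finitely presentable objects -/

section
variable {K : Type w} [Category.{u} K]

attribute [local instance] Cardinal.fact_isRegular_aleph0

theorem isFinitelyPresentable_colimit {J : Type} [SmallCategory J] [FinCategory J]
    (D : J ⥤ K) [HasColimit D] (h : ∀ j, IsFinitelyPresentable.{u} (D.obj j)) :
    IsFinitelyPresentable.{u} (colimit D) := by
  have : ∀ j, IsCardinalPresentable (D.obj j) Cardinal.aleph0.{u} := h
  have : HasLimitsOfShape Jᵒᵖ (Type u) := inferInstance
  exact isCardinalPresentable_of_isColimit' _ (colimit.isColimit D) _
    (hasCardinalLT_of_finite _ _ le_rfl)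

theorem exists_small_family (P : ObjectProperty K) [ObjectProperty.EssentiallySmall.{u} P] :
    ∃ (T : Type u) (S : T → K), (∀ t, P (S t)) ∧ ∀ X : K, P X → ∃ t, Nonempty (X ≅ S t) := by
  obtain ⟨Q, _, h₁, h₂⟩ := ObjectProperty.EssentiallySmall.exists_small_le.{u} P
  refine ⟨Shrink.{u} (Subtype Q), fun t => ((equivShrink _).symm t).1,
    fun t => h₁ _ ((equivShrink _).symm t).2, fun X hX => ?_⟩
  obtain ⟨Y, hY, ⟨e⟩⟩ := h₂ X hX
  exact ⟨equivShrink _ ⟨Y, hY⟩, ⟨e ≪≫ eqToIso (by simp)⟩⟩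

variable [IsLocallyFinitelyPresentable.{u} K]

theorem exists_directed_presentation (N : K) :
    ∃ (α : Type u) (_ : PartialOrder α) (_ : IsDirectedOrder α) (_ : Nonempty α)
      (p : ColimitPresentation α N), ∀ i, IsFinitelyPresentable.{u} (p.diag.obj i) := by
  obtain ⟨J, _, hJ, ⟨p⟩⟩ := (isCardinalFilteredGenerator_isCardinalPresentable K
    Cardinal.aleph0.{u}).exists_colimitsOfShape N
  have : IsFiltered J := (isCardinalFiltered_aleph0_iff.{u} J).1 hJ
  obtain ⟨α, _, h, _, F, _⟩ := IsFiltered.exists_directed J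
  exact ⟨α, _, h, ‹_›, p.toColimitPresentation.reindex F, fun i => p.prop_diag_obj _⟩

theorem hom_ext_of_finitelyPresentable {A B : K} {f g : A ⟶ B}
    (h : ∀ (Z : K) [IsFinitelyPresentable.{u} Z] (x : Z ⟶ A), x ≫ f = x ≫ g) : f = g := by
  obtain ⟨α, _, _, _, p, hp⟩ := exists_directed_presentation A
  exact p.isColimit.hom_ext fun i => h _ _

/-- Purity is tested against the codiagonal `X ⨿ X ⟶ X`: a map on `X ⨿ X` that factors through it
has equal components. -/
theorem mono_of_isPure {A B : K} (f : A ⟶ B) (hf : IsPure f) : Mono f := by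
  constructor
  intro Z u v huv
  refine hom_ext_of_finitelyPresentable fun X _ x => ?_
  have : IsFinitelyPresentable.{u} (X ⨿ X) :=
    isFinitelyPresentable_colimit _ (by rintro ⟨_ | _⟩ <;> assumption)
  obtain ⟨d, hd⟩ := hf (coprod.desc (𝟙 X) (𝟙 X)) (coprod.desc (x ≫ u) (x ≫ v)) (x ≫ u ≫ f)
    (by ext <;> simp [huv])
  have h₁ := congrArg (coprod.inl ≫ ·) hd
  have h₂ := congrArg (coprod.inr ≫ ·) hd
  simp only [coprod.desc_comp, coprod.inl_desc, coprod.inr_desc, Category.id_comp] at h₁ h₂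
  exact h₁.symm.trans h₂

/-! ### The Löwenheim–Skolem property -/

section
variable {α : Type u} [PartialOrder α] {N : K} (p : ColimitPresentation α N)

/-- The colimit of the restriction of a directed presentation to a subset of the index poset. -/
noncomputable def subColimit (A : Set α) : K :=
  colimit ((Subtype.mono_coe (· ∈ A)).functor ⋙ p.diag)

/-- The structure morphisms of `subColimit`. -/
noncomputable def subColimitι {A : Set α} {x : α} (hx : x ∈ A) : p.diag.obj x ⟶ subColimit p A :=
  colimit.ι ((Subtype.mono_coe (· ∈ A)).functor ⋙ p.diag) ⟨x, hx⟩

theorem subColimitι_w {A : Set α} {x y : α} (hx : x ∈ A) (hy : y ∈ A) (h : x ≤ y) :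
    p.diag.map (homOfLE h) ≫ subColimitι p hy = subColimitι p hx :=
  colimit.w ((Subtype.mono_coe (· ∈ A)).functor ⋙ p.diag)
    (homOfLE h : (⟨x, hx⟩ : Subtype (· ∈ A)) ⟶ ⟨y, hy⟩)

theorem subColimitι_w_assoc {A : Set α} {x y : α} (hx : x ∈ A) (hy : y ∈ A) (h : x ≤ y) {Z : K}
    (f : subColimit p A ⟶ Z) :
    p.diag.map (homOfLE h) ≫ subColimitι p hy ≫ f = subColimitι p hx ≫ f := by
  rw [← Category.assoc, subColimitι_w]

theorem subColimit_hom_ext {A : Set α} {Z : K} {f g : subColimit p A ⟶ Z}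
    (h : ∀ x (hx : x ∈ A), subColimitι p hx ≫ f = subColimitι p hx ≫ g) : f = g :=
  colimit.hom_ext fun x => h x.1 x.2

/-- The universal property of `subColimit`. -/
noncomputable def subColimitDesc {A : Set α} {Z : K} (f : ∀ x ∈ A, (p.diag.obj x ⟶ Z))
    (hf : ∀ x (hx : x ∈ A) y (hy : y ∈ A) (h : x ≤ y),
      p.diag.map (homOfLE h) ≫ f y hy = f x hx) : subColimit p A ⟶ Z :=
  colimit.desc _
    { pt := Z
      ι :=
        { app := fun x => f x.1 x.2
          naturality := fun x y h =>
            (hf x.1 x.2 y.1 y.2 (leOfHom h)).trans (Category.comp_id _).symm } }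

@[simp]
theorem subColimitι_desc {A : Set α} {Z : K} (f : ∀ x ∈ A, (p.diag.obj x ⟶ Z))
    (hf : ∀ x (hx : x ∈ A) y (hy : y ∈ A) (h : x ≤ y),
      p.diag.map (homOfLE h) ≫ f y hy = f x hx) {x : α} (hx : x ∈ A) :
    subColimitι p hx ≫ subColimitDesc p f hf = f x hx :=
  colimit.ι_desc _ _

@[simp]
theorem subColimitι_desc_assoc {A : Set α} {Z : K} (f : ∀ x ∈ A, (p.diag.obj x ⟶ Z))
    (hf : ∀ x (hx : x ∈ A) y (hy : y ∈ A) (h : x ≤ y),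
      p.diag.map (homOfLE h) ≫ f y hy = f x hx) {x : α} (hx : x ∈ A) {Z' : K} (g : Z ⟶ Z') :
    subColimitι p hx ≫ subColimitDesc p f hf ≫ g = f x hx ≫ g := by
  rw [← Category.assoc, subColimitι_desc]

/-- The functor `subColimit`, on a family of subsets. -/
noncomputable def subColimitFunctor (G : Set (Set α)) : G ⥤ K where
  obj A := subColimit p A.1
  map {A B} h := subColimitDesc p (fun x hx => subColimitι p (leOfHom h hx))
    fun x hx y hy h => subColimitι_w p _ _ h
  map_id A := subColimit_hom_ext p fun x hx => by simp
  map_comp f g := subColimit_hom_ext p fun x hx => by simp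

theorem subColimitι_functor_map_comp {G : Set (Set α)} {A B : G} (h : A ⟶ B) {x : α}
    (hx : x ∈ A.1) {Z : K} (f : (subColimitFunctor p G).obj B ⟶ Z) :
    subColimitι p hx ≫ (subColimitFunctor p G).map h ≫ f = subColimitι p (leOfHom h hx) ≫ f :=
  subColimitι_desc_assoc p (fun _ hx => subColimitι p (leOfHom h hx))
    (fun _ _ _ _ h => subColimitι_w p _ _ h) hx f

/-- Two members of `G` containing `x` can be compared inside a common larger member, so the choice
made in `coconeOfSubsets` is harmless. -/
theorem subColimitι_app_eq {G : Set (Set α)} (hdir : ∀ A ∈ G, ∀ B ∈ G, ∃ C ∈ G, A ⊆ C ∧ B ⊆ C)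
    (s : Cocone (subColimitFunctor p G)) {x : α} {A B : G} (hA : x ∈ A.1) (hB : x ∈ B.1) :
    subColimitι p hA ≫ s.ι.app A = subColimitι p hB ≫ s.ι.app B := by
  obtain ⟨C, hC, h₁, h₂⟩ := hdir A.1 A.2 B.1 B.2
  have key : ∀ (D : G) (hD : x ∈ D.1) (h : D.1 ⊆ C), subColimitι p hD ≫ s.ι.app D =
      subColimitι p (h hD) ≫ s.ι.app ⟨C, hC⟩ := fun D hD h =>
    (congrArg (subColimitι p hD ≫ ·) (s.w (homOfLE h : D ⟶ ⟨C, hC⟩))).symm.trans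
      (subColimitι_functor_map_comp p (homOfLE h : D ⟶ ⟨C, hC⟩) hD _)
  exact (key A hA h₁).trans (key B hB h₂).symm

/-- The cocone on a directed diagram induced by a cocone on the colimits of its restrictions to a
directed family of subsets of the index poset. -/
noncomputable def coconeOfSubsets {G : Set (Set α)} (hcov : ∀ x, ∃ A ∈ G, x ∈ A)
    (hdir : ∀ A ∈ G, ∀ B ∈ G, ∃ C ∈ G, A ⊆ C ∧ B ⊆ C) (s : Cocone (subColimitFunctor p G)) :
    Cocone p.diag where
  pt := s.pt
  ι :=
    { app := fun x => subColimitι p (hcov x).choose_spec.2 ≫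
        s.ι.app ⟨(hcov x).choose, (hcov x).choose_spec.1⟩
      naturality := fun x y f => by
        obtain ⟨C, hC, h₁, h₂⟩ := hdir _ (hcov x).choose_spec.1 _ (hcov y).choose_spec.1
        have e₁ := subColimitι_app_eq p hdir s
          (A := ⟨_, (hcov x).choose_spec.1⟩) (B := ⟨C, hC⟩) (hcov x).choose_spec.2
          (h₁ (hcov x).choose_spec.2)
        have e₂ := subColimitι_app_eq p hdir s
          (A := ⟨_, (hcov y).choose_spec.1⟩) (B := ⟨C, hC⟩) (hcov y).choose_spec.2
          (h₂ (hcov y).choose_spec.2)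
        have e₃ := subColimitι_w_assoc p (h₁ (hcov x).choose_spec.2)
          (h₂ (hcov y).choose_spec.2) (leOfHom f) (s.ι.app ⟨C, hC⟩)
        exact (congrArg (p.diag.map f ≫ ·) e₂).trans (e₃.trans (e₁.symm.trans
          (Category.comp_id _).symm)) }

/-- The morphism from the colimit of the restriction of a directed presentation. -/
noncomputable def subColimitToPt (A : Set α) : subColimit p A ⟶ N :=
  subColimitDesc p (fun x _ => p.ι.app x) fun _ _ _ _ h => p.w (homOfLE h)

@[simp]
theorem subColimitι_toPt {A : Set α} {x : α} (hx : x ∈ A) :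
    subColimitι p hx ≫ subColimitToPt p A = p.ι.app x :=
  subColimitι_desc ..

@[simp]
theorem subColimitι_toPt_assoc {A : Set α} {x : α} (hx : x ∈ A) {Z : K} (f : N ⟶ Z) :
    subColimitι p hx ≫ subColimitToPt p A ≫ f = p.ι.app x ≫ f := by
  rw [← Category.assoc, subColimitι_toPt]

/-- The presentation of `N` by the colimits of the restrictions of a directed presentation to a
directed family of subsets of the index poset. -/
noncomputable def presentationOfSubsets (G : Set (Set α)) (hcov : ∀ x, ∃ A ∈ G, x ∈ A)
    (hdir : ∀ A ∈ G, ∀ B ∈ G, ∃ C ∈ G, A ⊆ C ∧ B ⊆ C) :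
    ColimitPresentation G N where
  diag := subColimitFunctor p G
  ι :=
    { app := fun A => subColimitToPt p A.1
      naturality := fun A B f => subColimit_hom_ext p fun x hx => by
        refine (subColimitι_functor_map_comp p f hx _).trans ?_
        exact (subColimitι_toPt p _).trans ((subColimitι_toPt p hx).symm.trans
          (congrArg (subColimitι p hx ≫ ·) (Category.comp_id _).symm)) }
  isColimit :=
    { desc := fun s => p.isColimit.desc (coconeOfSubsets p hcov hdir s)
      fac := fun s A => subColimit_hom_ext p fun x hx =>
        (subColimitι_toPt_assoc p hx _).trans ((p.isColimit.fac _ x).trans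
          (subColimitι_app_eq p hdir s
            (A := ⟨_, (hcov x).choose_spec.1⟩) (hcov x).choose_spec.2 hx))
      uniq := fun s m hm => p.isColimit.hom_ext fun x => by
        refine Eq.trans ?_ (p.isColimit.fac (coconeOfSubsets p hcov hdir s) x).symm
        exact (subColimitι_toPt_assoc p (hcov x).choose_spec.2 m).symm.trans
          (congrArg (subColimitι p (hcov x).choose_spec.2 ≫ ·)
            (hm ⟨_, (hcov x).choose_spec.1⟩)) }

theorem exists_hom_subColimit {A : Set α} (hA : A.Nonempty)
    (hA' : ∀ x ∈ A, ∀ y ∈ A, ∃ z ∈ A, x ≤ z ∧ y ≤ z) {X : K} [IsFinitelyPresentable.{u} X]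
    (g : X ⟶ subColimit p A) :
    ∃ (x : α) (hx : x ∈ A) (g' : X ⟶ p.diag.obj x), g' ≫ subColimitι p hx = g := by
  have : Nonempty A := hA.to_subtype
  have : IsDirectedOrder A := ⟨fun x y => by
    obtain ⟨z, hz, h₁, h₂⟩ := hA' _ x.2 _ y.2
    exact ⟨⟨z, hz⟩, h₁, h₂⟩⟩
  obtain ⟨x, g', h⟩ := IsFinitelyPresentable.exists_hom_of_isColimit
    (colimit.isColimit ((Subtype.mono_coe (· ∈ A)).functor ⋙ p.diag)) g
  exact ⟨x.1, x.2, g', h⟩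

end

/-- Downward Löwenheim–Skolem. Restrict a directed presentation of `N` to index subsets of size
below `κ` that are closed under upper bounds and under witnesses for the factorizations occurring in
the definition of purity. Such subsets form a `κ`-filtered poset, and each has a `κ`-presentable
colimit that is pure in `N`. -/
theorem exists_pure_presentation : ∃ (κ : Cardinal.{u}) (_ : Fact κ.IsRegular),
    Cardinal.aleph0 ≤ κ ∧ ∀ N : K, ∃ (G : Type u) (_ : PartialOrder G)
      (_ : IsCardinalFiltered G κ) (p : ColimitPresentation G N),
      ∀ g, IsCardinalPresentable (p.diag.obj g) κ ∧ IsPure (p.ι.app g) := by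
  obtain ⟨T, S, hS, hS'⟩ := exists_small_family (ObjectProperty.isFinitelyPresentable.{u} K)
  -- `κ` exceeds the number of morphisms from any `S t` to all the `S t'`; the extra entry `none`
  -- makes it uncountable.
  obtain ⟨κ, hκ, hκ'⟩ := HasCardinalLT.exists_regular_cardinal_forall.{u}
    (fun o : Option T => o.elim (ULift.{u} ℕ) fun t => Σ t', (S t ⟶ S t'))
  have hκ₀ : Cardinal.aleph0 < κ := by
    simpa [HasCardinalLT] using hκ' none
  have : Fact κ.IsRegular := ⟨hκ⟩
  refine ⟨κ, this, hκ₀.le, fun N => ?_⟩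
  obtain ⟨α, _, _, _, p, hp⟩ := exists_directed_presentation N
  have hE : ∀ x, HasCardinalLT (Σ t, (p.diag.obj x ⟶ S t)) κ := fun x => by
    obtain ⟨t, ⟨e⟩⟩ := hS' _ (hp x)
    exact (hκ' (some t)).of_surjective (fun q => ⟨q.1, e.hom ≫ q.2⟩)
      (fun ⟨t', q⟩ => ⟨⟨t', e.inv ≫ q⟩, by simp⟩)
  -- If the coprojection at `x` factors through `q`, then so does a transition map from `x` to some
  -- `y`, because source and target of `q` are finitely presentable. If it does not, `y = x` is a
  -- dummy value.
  have hf : ∀ x (q : Σ t, (p.diag.obj x ⟶ S t)), ∃ y, (∃ k, q.2 ≫ k = p.ι.app x) →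
      ∃ (h : x ≤ y) (k : S q.1 ⟶ p.diag.obj y), q.2 ≫ k = p.diag.map (homOfLE h) := by
    rintro x ⟨t, q⟩
    by_cases hk : ∃ k, q ≫ k = p.ι.app x
    · obtain ⟨k, hk⟩ := hk
      have : IsFinitelyPresentable.{u} (S t) := hS t
      have := hp x
      obtain ⟨y, k', rfl⟩ := IsFinitelyPresentable.exists_hom_of_isColimit p.isColimit k
      obtain ⟨z, g₁, g₂, h⟩ := IsFinitelyPresentable.exists_eq_of_isColimit p.isColimit
        (q ≫ k') (𝟙 _) (by simpa using hk)
      refine ⟨z, fun _ => ⟨leOfHom g₂, k' ≫ p.diag.map g₁, ?_⟩⟩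
      rw [Category.assoc, Category.id_comp] at h
      exact h
    · exact ⟨x, fun h => (hk h).elim⟩
  choose f hf using hf
  choose s hs₁ hs₂ using fun x y : α => exists_ge_ge x y
  let G : Set (Set α) := {A | HasCardinalLT A κ ∧ A.Nonempty ∧ (∀ x ∈ A, ∀ q, f x q ∈ A) ∧
    ∀ x ∈ A, ∀ y ∈ A, s x y ∈ A}
  have hG : ∀ A : Set α, HasCardinalLT A κ → ∃ B ∈ G, A ⊆ B := fun A hA => by
    obtain ⟨B, h, h₁, h₂, h₃⟩ := exists_closed_superset hκ₀ hE f s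
      (A ∪ {Classical.arbitrary α}) (hasCardinalLT_union hκ₀.le hA
        (hasCardinalLT_of_finite _ _ hκ₀.le))
    exact ⟨B, ⟨h₁, ⟨_, h (Or.inr rfl)⟩, h₂, h₃⟩, Set.subset_union_left.trans h⟩
  have hGf : IsCardinalFiltered G κ := isCardinalFiltered_preorder _ _ fun I t hI => by
    obtain ⟨B, hB, h⟩ := hG (⋃ i, (t i).1) (hasCardinalLT_iUnion _
      ((hasCardinalLT_iff_cardinal_mk_lt _ _).2 hI) fun i => (t i).2.1)
    exact ⟨⟨B, hB⟩, fun i => (Set.subset_iUnion (fun i => (t i).1) i).trans h⟩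
  refine ⟨G, inferInstance, hGf, presentationOfSubsets p G (fun x => ?_) fun A hA B hB => ?_,
    fun A => ⟨?_, ?_⟩⟩
  · obtain ⟨B, hB, h⟩ := hG {x} (hasCardinalLT_of_finite _ _ hκ₀.le)
    exact ⟨B, hB, h rfl⟩
  · obtain ⟨C, hC, h⟩ := hG (A ∪ B) (hasCardinalLT_union hκ₀.le hA.1 hB.1)
    exact ⟨C, hC, Set.subset_union_left.trans h, Set.subset_union_right.trans h⟩
  · have : ∀ x : A.1, IsCardinalPresentable
        (((Subtype.mono_coe (· ∈ A.1)).functor ⋙ p.diag).obj x) κ := fun x =>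
      have : IsCardinalPresentable (p.diag.obj x) Cardinal.aleph0.{u} := hp x
      isCardinalPresentable_of_le (p.diag.obj x) hκ₀.le
    refine isCardinalPresentable_of_isColimit' _
      (colimit.isColimit ((Subtype.mono_coe (· ∈ A.1)).functor ⋙ p.diag)) κ ?_
    have := hasCardinalLT_prod hκ₀.le A.2.1 A.2.1
    refine this.of_injective (fun φ : Arrow A.1 => (φ.left, φ.right)) fun φ ψ h => ?_
    obtain ⟨h₁, h₂⟩ := Prod.ext_iff.1 h
    exact Arrow.ext h₁ h₂ (Subsingleton.elim _ _)
  · intro X Y _ _ h (g : X ⟶ subColimit p A.1) (k : Y ⟶ N)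
      (hk : g ≫ subColimitToPt p A.1 = h ≫ k)
    change ∃ d : Y ⟶ subColimit p A.1, h ≫ d = g
    obtain ⟨x, hx, g, rfl⟩ := exists_hom_subColimit p A.2.2.1
      (fun x hx y hy => ⟨s x y, A.2.2.2.2 x hx y hy, hs₁ _ _, hs₂ _ _⟩) g
    rw [Category.assoc, subColimitι_toPt] at hk
    have := hp x
    -- The pushout turns the square into a factorization of the coprojection at `x` through a
    -- finitely presentable object, which is the situation handled by closure under `f`.
    have : IsFinitelyPresentable.{u} (pushout g h) :=
      isFinitelyPresentable_colimit _ (by rintro (_ | _ | _) <;> assumption)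
    obtain ⟨t, ⟨e⟩⟩ := hS' _ this
    obtain ⟨hle, k', hk'⟩ := hf x ⟨t, pushout.inl g h ≫ e.hom⟩
      ⟨e.inv ≫ pushout.desc (p.ι.app x) k hk, by
        rw [Category.assoc, Iso.hom_inv_id_assoc]
        exact pushout.inl_desc _ _ hk⟩
    refine ⟨pushout.inr g h ≫ e.hom ≫ k' ≫ subColimitι p (A.2.2.2.1 _ hx _), ?_⟩
    rw [← pushout.condition_assoc, ← subColimitι_w p hx (A.2.2.2.1 _ hx _) hle, ← hk']
    simp
end

/-! ### Interpretations in terms of elements -/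

section
variable {A : Type w} [Category.{u} A]

namespace IsInterpretation

theorem existsUnique {F : A ⥤ Type u} (hF : IsInterpretation A F) {J : Type u} {X : J → A}
    {c : Fan X} (hc : IsLimit c) (y : ∀ j, F.obj (X j)) :
    ∃! x : F.obj c.pt, ∀ j, F.map (c.proj j) x = y j := by
  have := hF.1 J
  obtain ⟨x, hx, hx'⟩ := (Types.isLimit_iff _).1 ⟨isLimitOfPreserves F hc⟩ (fun j => y j.as)
    (by rintro ⟨i⟩ ⟨j⟩ ⟨⟨h⟩⟩; obtain rfl : i = j := h; simp)
  exact ⟨x, fun j => hx ⟨j⟩, fun x' h => hx' x' fun j => h j.as⟩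

theorem fan_ext {F : A ⥤ Type u} (hF : IsInterpretation A F) {J : Type u} {X : J → A}
    {c : Fan X} (hc : IsLimit c) {x y : F.obj c.pt}
    (h : ∀ j, F.map (c.proj j) x = F.map (c.proj j) y) : x = y :=
  (hF.existsUnique hc fun j => F.map (c.proj j) y).unique h fun _ => rfl

section
variable {F : A ⥤ Type u} (hF : IsInterpretation A F) {J : Type u} [PartialOrder J]
  [IsDirectedOrder J] [Nonempty J] {D : J ⥤ A} {c : Cocone D} (hc : IsColimit c)
include hF hc

theorem exists_rep (x : F.obj c.pt) : ∃ j, ∃ y : F.obj (D.obj j), F.map (c.ι.app j) y = x := by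
  have := hF.2 J
  exact Types.jointly_surjective_of_isColimit (isColimitOfPreserves F hc) x

theorem exists_map_eq {j : J} {x y : F.obj (D.obj j)}
    (h : F.map (c.ι.app j) x = F.map (c.ι.app j) y) :
    ∃ (k : J) (f : j ⟶ k), F.map (D.map f) x = F.map (D.map f) y := by
  have := hF.2 J
  exact (Types.FilteredColimit.isColimit_eq_iff' (isColimitOfPreserves F hc) x y).1 h

end

theorem mk {F : A ⥤ Type u}
    (h₁ : ∀ (J : Type u) (X : J → A) (c : Fan X), IsLimit c → ∀ y : ∀ j, F.obj (X j),
      ∃! x : F.obj c.pt, ∀ j, F.map (c.proj j) x = y j)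
    (h₂ : ∀ (J : Type u) [PartialOrder J] [IsDirectedOrder J] [Nonempty J] (D : J ⥤ A)
      (c : Cocone D), IsColimit c →
      (∀ x : F.obj c.pt, ∃ j, ∃ y : F.obj (D.obj j), F.map (c.ι.app j) y = x) ∧
      ∀ (j : J) (x y : F.obj (D.obj j)), F.map (c.ι.app j) x = F.map (c.ι.app j) y →
        ∃ (k : J) (f : j ⟶ k), F.map (D.map f) x = F.map (D.map f) y) :
    IsInterpretation A F := by
  refine ⟨fun J => ⟨fun {D} => ⟨fun {c} hc => ?_⟩⟩, fun J _ _ _ => ⟨fun {D} => ⟨fun {c} hc => ?_⟩⟩⟩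
  · rw [Types.isLimit_iff]
    intro s hs
    let e : D ≅ Discrete.functor fun j => D.obj ⟨j⟩ := Discrete.natIsoFunctor
    have hc' : IsLimit (Fan.mk c.pt fun j => c.π.app ⟨j⟩) :=
      ((IsLimit.postcomposeHomEquiv e c).symm hc).ofIsoLimit
        (Cone.ext (Iso.refl _) (by rintro ⟨j⟩; simp [e]))
    obtain ⟨x, hx, hx'⟩ := h₁ J _ _ hc' fun j => s ⟨j⟩
    exact ⟨x, fun j => hx j.as, fun x' h => hx' x' fun j => h ⟨j⟩⟩
  · obtain ⟨h, h'⟩ := h₂ J D c hc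
    refine ⟨Types.FilteredColimit.isColimitOf' _ _ (fun x => ?_) h'⟩
    obtain ⟨j, y, rfl⟩ := h x
    exact ⟨j, y, rfl⟩

attribute [local instance] Cardinal.fact_isRegular_aleph0 in
-- Limits of functors are pointwise; limits commute with products, and finite limits commute with
-- directed colimits of sets.
theorem of_isLimit {J : Type} [SmallCategory J] [FinCategory J] {F : J ⥤ A ⥤ Type u} {c : Cone F}
    (hc : IsLimit c) (hF : ∀ j, IsInterpretation A (F.obj j)) : IsInterpretation A c.pt := by
  have hc' : ∀ X, IsLimit (((evaluation A (Type u)).obj X).mapCone c) := fun X =>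
    isLimitOfPreserves _ hc
  refine mk (fun I X d hd y => ?_) fun I _ _ _ D d hd => ?_
  · let s : ∀ j, (F.obj j).obj d.pt := fun j =>
      ((hF j).existsUnique hd fun i => (c.π.app j).app _ (y i)).choose
    have hs : ∀ j i, (F.obj j).map (d.proj i) (s j) = (c.π.app j).app _ (y i) := fun j =>
      ((hF j).existsUnique hd fun i => (c.π.app j).app _ (y i)).choose_spec.1
    obtain ⟨x, hx, hx'⟩ := (Types.isLimit_iff _).1 ⟨hc' d.pt⟩ s fun {j k} f => by
      refine (hF k).fan_ext hd fun i => ?_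
      have h₁ := NatTrans.naturality_apply (F.map f) (d.proj i) (s j)
      have h₂ := congrArg (fun φ => φ.app (X i) (y i)) (c.w f)
      refine h₁.symm.trans ?_
      rw [hs, hs]
      exact h₂
    refine ⟨x, fun i => ?_, fun x' h => hx' x' fun j => (hF j).fan_ext hd fun i => ?_⟩
    · refine (Types.isLimitEquivSections (hc' (X i))).injective (Subtype.ext (funext fun j => ?_))
      simp only [Types.isLimitEquivSections_apply]
      refine (NatTrans.naturality_apply (c.π.app j) (d.proj i) x).trans ?_
      exact (congrArg _ (hx j)).trans (hs j i)
    · rw [hs, ← h]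
      exact (NatTrans.naturality_apply (c.π.app j) (d.proj i) x').symm
  · have : IsCardinalFiltered I Cardinal.aleph0.{u} :=
      (isCardinalFiltered_aleph0_iff.{u} I).2 inferInstance
    have := Functor.Accessible.Limits.isColimitMapCocone c hc' Cardinal.aleph0.{u}
      (hasCardinalLT_of_finite _ _ le_rfl) d fun j =>
        have := (hF j).2 I
        isColimitOfPreserves (F.obj j) hd
    exact ⟨fun x => Types.jointly_surjective_of_isColimit this x,
      fun j x y h => (Types.FilteredColimit.isColimit_eq_iff' this x y).1 h⟩

/-- For products: by choice, elements and witnesses of equality lift coordinatewise to `F` and `R`.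
For directed colimits: a witness in `R` of an equality already lives at some stage, and its two
projections match the given elements at a later one. -/
theorem of_surjective {F R G : A ⥤ Type u} (hF : IsInterpretation A F) (hR : IsInterpretation A R)
    (π : F ⟶ G) (hπ : ∀ X, Function.Surjective (π.app X)) (p₁ p₂ : R ⟶ F)
    (h : ∀ X x y, π.app X x = π.app X y ↔ ∃ r, p₁.app X r = x ∧ p₂.app X r = y) :
    IsInterpretation A G := by
  refine mk (fun I X d hd y => ?_) fun I _ _ _ D d hd => ⟨fun x => ?_, fun j x y hxy => ?_⟩
  · choose z hz using fun i => hπ (X i) (y i)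
    obtain ⟨x, hx, -⟩ := hF.existsUnique hd z
    refine ⟨π.app _ x, fun i => ?_, fun y' hy' => ?_⟩
    · rw [← NatTrans.naturality_apply, hx, hz]
    · obtain ⟨x', rfl⟩ := hπ _ y'
      have : ∀ i, ∃ r, p₁.app (X i) r = F.map (d.proj i) x' ∧ p₂.app (X i) r = z i := fun i => by
        rw [← h, hz, NatTrans.naturality_apply, hy']
      choose r hr₁ hr₂ using this
      obtain ⟨r', hr', -⟩ := hR.existsUnique hd r
      refine (h _ _ _).2 ⟨r', hF.fan_ext hd fun i => ?_, hF.fan_ext hd fun i => ?_⟩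
      · rw [← NatTrans.naturality_apply, hr', hr₁]
      · rw [← NatTrans.naturality_apply, hr', hr₂, hx]
  · obtain ⟨z, rfl⟩ := hπ _ x
    obtain ⟨j, z, rfl⟩ := hF.exists_rep hd z
    exact ⟨j, π.app _ z, (NatTrans.naturality_apply π _ z).symm⟩
  · obtain ⟨x, rfl⟩ := hπ _ x
    obtain ⟨y, rfl⟩ := hπ _ y
    rw [← NatTrans.naturality_apply, ← NatTrans.naturality_apply, h] at hxy
    obtain ⟨r, hr₁, hr₂⟩ := hxy
    obtain ⟨k, r, rfl⟩ := hR.exists_rep hd r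
    rw [NatTrans.naturality_apply] at hr₁ hr₂
    obtain ⟨l, hl₁, hl₂⟩ := exists_ge_ge j k
    have key : ∀ (p : R ⟶ F) (z : F.obj (D.obj j)),
        F.map (d.ι.app k) (p.app _ r) = F.map (d.ι.app j) z →
        ∃ (m : I) (f : l ⟶ m), F.map (D.map (homOfLE hl₂ ≫ f)) (p.app _ r) =
          F.map (D.map (homOfLE hl₁ ≫ f)) z := fun p z hz => by
      obtain ⟨m, f, hm⟩ := hF.exists_map_eq hd (j := l)
        (x := F.map (D.map (homOfLE hl₂)) (p.app _ r)) (y := F.map (D.map (homOfLE hl₁)) z) (by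
          have e : ∀ {i : I} (g : i ⟶ l) (t : F.obj (D.obj i)),
              F.map (d.ι.app l) (F.map (D.map g) t) = F.map (d.ι.app i) t := fun g t => by
            rw [← comp_apply, ← Functor.map_comp, d.w]
          exact (e (homOfLE hl₂) (p.app _ r)).trans (hz.trans (e (homOfLE hl₁) z).symm))
      exact ⟨m, f, by simpa using hm⟩
    obtain ⟨m₁, f₁, h₁⟩ := key p₁ x hr₁
    obtain ⟨m₂, f₂, h₂⟩ := key p₂ y hr₂
    obtain ⟨m, g₁, g₂⟩ := exists_ge_ge m₁ m₂
    refine ⟨m, homOfLE hl₁ ≫ f₁ ≫ homOfLE g₁, ?_⟩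
    rw [← NatTrans.naturality_apply, ← NatTrans.naturality_apply, h]
    refine ⟨R.map (D.map (homOfLE hl₂ ≫ f₁ ≫ homOfLE g₁)) r, ?_, ?_⟩
    · rw [NatTrans.naturality_apply]
      simpa using congrArg (F.map (D.map (homOfLE g₁))) h₁
    · rw [NatTrans.naturality_apply]
      have : f₁ ≫ homOfLE g₁ = f₂ ≫ homOfLE g₂ := Subsingleton.elim _ _
      rw [this]
      simpa using congrArg (F.map (D.map (homOfLE g₂))) h₂

end IsInterpretation

end

/-! ### `A⁺` is exact -/

section
variable {A : Type w} [Category.{u} A]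

instance isClosedUnderLimitsOfShape_isInterpretation (J : Type) [SmallCategory J]
    [FinCategory J] : (IsInterpretation A).IsClosedUnderLimitsOfShape J where
  limitsOfShape_le := by
    rintro F ⟨h⟩
    exact IsInterpretation.of_isLimit h.isLimit h.prop_diag_obj

instance hasFiniteLimits_plus : HasFiniteLimits (Plus A) :=
  ⟨fun _ => inferInstance⟩

instance preservesFiniteLimits_plusι : PreservesFiniteLimits (IsInterpretation A).ι :=
  ⟨fun _ => inferInstance⟩

namespace Plus

variable (A) in
/-- Evaluation at an object. -/
abbrev eval (X : A) : Plus A ⥤ Type u := (IsInterpretation A).ι ⋙ (evaluation A (Type u)).obj X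

theorem naturality {F G : Plus A} (f : F ⟶ G) {X Y : A} (h : X ⟶ Y) (x : F.obj.obj X) :
    f.hom.app Y (F.obj.map h x) = G.obj.map h (f.hom.app X x) :=
  NatTrans.naturality_apply f.hom h x

theorem hom_ext {F G : Plus A} {f g : F ⟶ G} (h : ∀ X x, f.hom.app X x = g.hom.app X x) :
    f = g := by
  apply ObjectProperty.hom_ext
  ext X x
  exact h X x

theorem exists_of_isPullback {P F G H : Plus A} {p : P ⟶ F} {q : P ⟶ G} {f : F ⟶ H} {g : G ⟶ H}
    (h : IsPullback p q f g) {X : A} (x : F.obj.obj X) (y : G.obj.obj X)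
    (hxy : f.hom.app X x = g.hom.app X y) : ∃ z, p.hom.app X z = x ∧ q.hom.app X z = y :=
  Types.exists_of_isPullback (h.map (eval A X)) x y hxy

/-- The morphism given by a pointwise unique choice. -/
theorem exists_hom_of_existsUnique {F G : Plus A} (p : ∀ X, F.obj.obj X → G.obj.obj X → Prop)
    (h : ∀ X x, ∃! y, p X x y)
    (hp : ∀ {X Y : A} (f : X ⟶ Y) x y, p X x y → p Y (F.obj.map f x) (G.obj.map f y)) :
    ∃ f : F ⟶ G, ∀ X x, p X x (f.hom.app X x) := by
  choose f hf hf' using h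
  refine ⟨ObjectProperty.homMk
    { app := fun X => TypeCat.ofHom (f X)
      naturality := fun X Y g => ?_ }, hf⟩
  ext x
  exact (hf' _ _ _ (hp g _ _ (hf X x))).symm

theorem isPullback_of_existsUnique {P F G H : Plus A} {p : P ⟶ F} {q : P ⟶ G} {f : F ⟶ H}
    {g : G ⟶ H} (w : p ≫ f = q ≫ g) (h : ∀ X x y, f.hom.app X x = g.hom.app X y →
      ∃! z, p.hom.app X z = x ∧ q.hom.app X z = y) : IsPullback p q f g := by
  have w' : ∀ {S : Plus A} (s : S ⟶ F) (t : S ⟶ G), s ≫ f = t ≫ g →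
      ∃ l : S ⟶ P, ∀ X x, p.hom.app X (l.hom.app X x) = s.hom.app X x ∧
        q.hom.app X (l.hom.app X x) = t.hom.app X x := fun {S} s t hst => by
    refine exists_hom_of_existsUnique
      (fun X x z => p.hom.app X z = s.hom.app X x ∧ q.hom.app X z = t.hom.app X x)
      (fun X x => h X _ _ ?_) fun {X Y} k x z hz => ?_
    · exact congrArg (fun φ : S ⟶ H => φ.hom.app X x) hst
    · simp only [naturality, hz, and_self]
  refine ⟨⟨w⟩, ⟨PullbackCone.IsLimit.mk w (fun s => (w' s.fst s.snd s.condition).choose)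
    (fun s => hom_ext fun X x => ((w' s.fst s.snd s.condition).choose_spec X x).1)
    (fun s => hom_ext fun X x => ((w' s.fst s.snd s.condition).choose_spec X x).2)
    fun s m h₁ h₂ => hom_ext fun X x => ?_⟩⟩
  refine (h X (s.fst.hom.app X x) (s.snd.hom.app X x)
    (congrArg (fun φ : s.pt ⟶ H => φ.hom.app X x) s.condition)).unique ⟨?_, ?_⟩
    ((w' s.fst s.snd s.condition).choose_spec X x)
  · exact congrArg (fun φ : s.pt ⟶ F => φ.hom.app X x) h₁
  · exact congrArg (fun φ : s.pt ⟶ G => φ.hom.app X x) h₂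

theorem exists_desc {F G H : Plus A} {π : F ⟶ G} (hπ : ∀ X, Function.Surjective (π.hom.app X))
    (f : F ⟶ H) (hf : ∀ X x y, π.hom.app X x = π.hom.app X y → f.hom.app X x = f.hom.app X y) :
    ∃ d : G ⟶ H, π ≫ d = f := by
  obtain ⟨d, hd⟩ := exists_hom_of_existsUnique (F := G) (G := H)
    (fun X y z => ∃ x, π.hom.app X x = y ∧ f.hom.app X x = z)
    (fun X y => by
      obtain ⟨x, rfl⟩ := hπ X y
      exact ⟨_, ⟨x, rfl, rfl⟩, fun z ⟨x', h, hz⟩ => hz.symm.trans (hf _ _ _ h)⟩)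
    (by
      rintro X Y h _ _ ⟨x, rfl, rfl⟩
      exact ⟨F.obj.map h x, naturality .., naturality ..⟩)
  refine ⟨d, hom_ext fun X x => ?_⟩
  obtain ⟨x', h, hx'⟩ := hd X (π.hom.app X x)
  exact hx'.symm.trans (hf _ _ _ h)

theorem epi_of_surjective {F G : Plus A} {π : F ⟶ G}
    (hπ : ∀ X, Function.Surjective (π.hom.app X)) : Epi π where
  left_cancellation f g h := hom_ext fun X y => by
    obtain ⟨x, rfl⟩ := hπ X y
    exact congrArg (fun φ : F ⟶ _ => φ.hom.app X x) h

/-- A pointwise surjective morphism is the coequalizer of any pair of morphisms that pointwise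
generates its kernel. -/
theorem exists_isColimit_of_surjective {F G R : Plus A} {π : F ⟶ G}
    (hπ : ∀ X, Function.Surjective (π.hom.app X)) {p q : R ⟶ F} (w : p ≫ π = q ≫ π)
    (h : ∀ X x y, π.hom.app X x = π.hom.app X y → ∃ r, p.hom.app X r = x ∧ q.hom.app X r = y) :
    Nonempty (IsColimit (Cofork.ofπ π w)) := by
  have key : ∀ s : Cofork p q, ∃ d : G ⟶ s.pt, π ≫ d = s.π := fun s =>
    exists_desc hπ s.π fun X x y hxy => by
      obtain ⟨r, rfl, rfl⟩ := h X x y hxy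
      exact congrArg (fun φ : R ⟶ s.pt => φ.hom.app X r) s.condition
  have := epi_of_surjective hπ
  exact ⟨Cofork.IsColimit.mk _ (fun s => (key s).choose) (fun s => (key s).choose_spec)
    fun s m hm => (cancel_epi π).1 (hm.trans (key s).choose_spec.symm)⟩

theorem isRegularEpi_of_surjective {F G : Plus A} {π : F ⟶ G}
    (hπ : ∀ X, Function.Surjective (π.hom.app X)) : IsRegularEpi π := by
  obtain ⟨h⟩ := exists_isColimit_of_surjective hπ (pullback.condition (f := π) (g := π))
    fun X x y h => exists_of_isPullback (IsPullback.of_hasPullback π π) x y h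
  exact ⟨⟨{ W := _, left := _, right := _, w := _, isColimit := h }⟩⟩

theorem exists_quotient {F R : Plus A} (p q : R ⟶ F)
    (h : ∀ X, Equivalence fun x y => ∃ r, p.hom.app X r = x ∧ q.hom.app X r = y) :
    ∃ (G : Plus A) (π : F ⟶ G), (∀ X, Function.Surjective (π.hom.app X)) ∧
      ∀ X x y, π.hom.app X x = π.hom.app X y ↔ ∃ r, p.hom.app X r = x ∧ q.hom.app X r = y := by
  let s : ∀ X, Setoid (F.obj.obj X) := fun X => ⟨_, h X⟩
  let G : A ⥤ Type u :=
    { obj := fun X => Quotient (s X)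
      map := fun {X Y} f => TypeCat.ofHom (Quotient.map (F.obj.map f) (by
        rintro _ _ ⟨r, rfl, rfl⟩
        exact ⟨R.obj.map f r, naturality .., naturality ..⟩))
      map_id := fun X => by
        ext x
        obtain ⟨x, rfl⟩ := Quotient.exists_rep x
        simp
      map_comp := fun f g => by
        ext x
        obtain ⟨x, rfl⟩ := Quotient.exists_rep x
        simp }
  let π : F.obj ⟶ G :=
    { app := fun X => TypeCat.ofHom (Quotient.mk (s X))
      naturality := fun X Y f => rfl }
  have hπ : ∀ X, Function.Surjective (π.app X) := fun X => Quotient.exists_rep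
  have hπ' : ∀ X x y, π.app X x = π.app X y ↔ ∃ r, p.hom.app X r = x ∧ q.hom.app X r = y :=
    fun X x y => Quotient.eq (r := s X)
  exact ⟨⟨G, F.property.of_surjective R.property π hπ p.hom q.hom hπ'⟩, ObjectProperty.homMk π,
    hπ, hπ'⟩

/-- Factor `f = π ≫ m` through the pointwise quotient by its kernel pair. As `f` is a coequalizer,
`π` factors as `f ≫ d`, and `d` is a section of `m`; so `y` is the image under `m` of a point that
`π` reaches. -/
theorem surjective_of_isRegularEpi {F G : Plus A} (f : F ⟶ G) [IsRegularEpi f] (X : A) :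
    Function.Surjective (f.hom.app X) := by
  have hR := IsPullback.of_hasPullback f f
  have hR' : ∀ X x y, f.hom.app X x = f.hom.app X y ↔
      ∃ r, (pullback.fst f f).hom.app X r = x ∧ (pullback.snd f f).hom.app X r = y :=
    fun X x y => ⟨exists_of_isPullback hR x y, by
      rintro ⟨r, rfl, rfl⟩
      exact congrArg (fun φ : _ ⟶ G => φ.hom.app X r) hR.w⟩
  obtain ⟨I, π, hπ, hπ'⟩ := exists_quotient (pullback.fst f f) (pullback.snd f f) fun X => by
    simp only [← hR']
    exact ⟨fun _ => rfl, fun h => h.symm, fun h h' => h.trans h'⟩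
  obtain ⟨m, hm⟩ := exists_desc hπ f fun X x y h => (hR' X x y).2 ((hπ' X x y).1 h)
  obtain ⟨d, hd⟩ := Cofork.IsColimit.desc' (IsRegularEpi.isColimit f) π (hom_ext fun X x =>
    (hπ' _ _ _).2 ((hR' _ _ _).1 (congrArg (fun φ : _ ⟶ G => φ.hom.app X x) (IsRegularEpi.w f))))
  replace hd : f ≫ d = π := hd
  have hf : Epi f := inferInstance
  have hdm : d ≫ m = 𝟙 G := by rw [← cancel_epi f, reassoc_of% hd, hm, Category.comp_id]
  intro y
  obtain ⟨x, hx⟩ := hπ X (d.hom.app X y)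
  refine ⟨x, ?_⟩
  rw [← hm]
  refine (congrArg (m.hom.app X) hx).trans ?_
  exact congrArg (fun φ : G ⟶ G => φ.hom.app X y) hdm

/-- Passes from morphisms to elements: `(r, r')` is an element of the equalizer, on the kernel pair
of `p`, of the two composites to `G`, and joint monicity makes the two projections of that equalizer
coincide. -/
theorem eq_of_jointlyMono {R F G : Plus A} {p : R ⟶ F} {q : R ⟶ G} (h : JointlyMono₂ p q) {X : A}
    {r r' : R.obj.obj X} (hp : p.hom.app X r = p.hom.app X r')
    (hq : q.hom.app X r = q.hom.app X r') : r = r' := by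
  obtain ⟨z, rfl, rfl⟩ := exists_of_isPullback (IsPullback.of_hasPullback p p) r r' hp
  let E := equalizer (pullback.fst p p ≫ q) (pullback.snd p p ≫ q)
  obtain ⟨e, he, -⟩ := Types.unique_of_type_equalizer _ _
    (isLimitForkMapOfIsLimit (eval A X) _ (equalizerIsEqualizer
      (pullback.fst p p ≫ q) (pullback.snd p p ≫ q))) z hq
  have := h.right_cancellation
    (equalizer.ι (pullback.fst p p ≫ q) (pullback.snd p p ≫ q) ≫ pullback.fst p p)
    (equalizer.ι (pullback.fst p p ≫ q) (pullback.snd p p ≫ q) ≫ pullback.snd p p)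
    (by simp [pullback.condition]) (by simpa using equalizer.condition _ _)
  rw [← he]
  exact congrArg (fun φ : _ ⟶ R => φ.hom.app X e) this

variable (A) in
-- Regular epimorphisms are the pointwise surjections, and quotients by equivalence relations exist
-- pointwise, so exactness is inherited from sets.
theorem isExact : IsExact (Plus A) where
  regular :=
    { hasCoequalizer_of_isKernelPair := fun {F G R f p q} h => by
        have hR' : ∀ X x y, f.hom.app X x = f.hom.app X y ↔
            ∃ r, p.hom.app X r = x ∧ q.hom.app X r = y :=
          fun X x y => ⟨exists_of_isPullback h x y, by
            rintro ⟨r, rfl, rfl⟩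
            exact congrArg (fun φ : _ ⟶ G => φ.hom.app X r) h.w⟩
        obtain ⟨I, π, hπ, hπ'⟩ := exists_quotient p q fun X => by
          simp only [← hR']
          exact ⟨fun _ => rfl, fun h => h.symm, fun h h' => h.trans h'⟩
        obtain ⟨h⟩ := exists_isColimit_of_surjective hπ
          (hom_ext fun X r => (hπ' _ _ _).2 ⟨r, rfl, rfl⟩) fun X x y h => (hπ' X x y).1 h
        exact ⟨⟨_, h⟩⟩
      regularEpiIsStableUnderBaseChange := ⟨fun {X Y Y' S f g f' g'} h hg => by
        have : IsRegularEpi g := hg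
        refine isRegularEpi_of_surjective fun Z x => ?_
        obtain ⟨y, hy⟩ := surjective_of_isRegularEpi g Z (f.hom.app Z x)
        obtain ⟨z, -, hz⟩ := exists_of_isPullback h y x hy
        exact ⟨z, hz⟩⟩ }
  effective := by
    rintro R F p q ⟨⟨e⟩⟩
    obtain ⟨G, π, hπ, hπ'⟩ := exists_quotient p q fun X => by
      refine ⟨fun x => ⟨e.r.hom.app X x, ?_, ?_⟩, ?_, ?_⟩
      · exact congrArg (fun φ : F ⟶ F => φ.hom.app X x) e.reflexivity₁
      · exact congrArg (fun φ : F ⟶ F => φ.hom.app X x) e.reflexivity₂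
      · rintro _ _ ⟨r, rfl, rfl⟩
        refine ⟨e.s.hom.app X r, ?_, ?_⟩
        · exact congrArg (fun φ : R ⟶ F => φ.hom.app X r) e.symmetry₁
        · exact congrArg (fun φ : R ⟶ F => φ.hom.app X r) e.symmetry₂
      · rintro _ _ _ ⟨r, rfl, rfl⟩ ⟨r', h, rfl⟩
        have hc : IsPullback e.c.fst e.c.snd q p := ⟨⟨e.c.condition⟩, ⟨e.isLimit.ofIsoLimit
          (PullbackCone.ext (Iso.refl _))⟩⟩
        obtain ⟨z, rfl, rfl⟩ := exists_of_isPullback hc r r' h.symm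
        refine ⟨e.t.hom.app X z, ?_, ?_⟩
        · exact congrArg (fun φ : e.c.pt ⟶ F => φ.hom.app X z) e.transitivity₁
        · exact congrArg (fun φ : e.c.pt ⟶ F => φ.hom.app X z) e.transitivity₂
    refine ⟨G, π, isPullback_of_existsUnique (hom_ext fun X r => (hπ' _ _ _).2 ⟨r, rfl, rfl⟩)
      fun X x y hxy => ?_⟩
    obtain ⟨r, rfl, rfl⟩ := (hπ' X x y).1 hxy
    exact ⟨r, ⟨rfl, rfl⟩, fun r' h => eq_of_jointlyMono ⟨e.right_cancellation⟩ h.1 h.2⟩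

end Plus

end

/-! ### Descent of natural transformations along a covering functor -/

section
variable {C : Type u₁} [Category.{v₁} C] {D : Type u₂} [Category.{v₂} D]

/-- A functor `Q : C ⥤ D` such that every object of `D` is a regular quotient of an object in the
image of `Q`, and every subobject of `Q.obj X` is covered by the image of a morphism to `X`. -/
structure IsCovering (Q : C ⥤ D) : Prop where
  exists_cover (F : D) : ∃ (X : C) (g : Q.obj X ⟶ F), IsRegularEpi g
  exists_cover_subobject {X : C} {W : D} (i : W ⟶ Q.obj X) [Mono i] :
    ∃ (Z : C) (m : Z ⟶ X) (e : Q.obj Z ⟶ W), IsRegularEpi e ∧ e ≫ i = Q.map m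

namespace IsCovering

variable {Q : C ⥤ D} (hQ : IsCovering Q) [HasFiniteLimits C] [PreservesFiniteLimits Q]
include hQ

/-- The pullback is a subobject of `Q.obj X ⨯ Q.obj Y ≅ Q.obj (X ⨯ Y)`. -/
theorem exists_cover_pullback [HasFiniteLimits D] {X Y : C} {F : D} (g : Q.obj X ⟶ F)
    (h : Q.obj Y ⟶ F) : ∃ (Z : C) (m : Z ⟶ X) (n : Z ⟶ Y) (e : Q.obj Z ⟶ pullback g h),
      IsRegularEpi e ∧ e ≫ pullback.fst g h = Q.map m ∧ e ≫ pullback.snd g h = Q.map n := by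
  let i : pullback g h ⟶ Q.obj (X ⨯ Y) :=
    prod.lift (pullback.fst g h) (pullback.snd g h) ≫ inv (prodComparison Q X Y)
  have hi₁ : i ≫ Q.map prod.fst = pullback.fst g h := by
    rw [Category.assoc, inv_prodComparison_map_fst]
    exact prod.lift_fst _ _
  have hi₂ : i ≫ Q.map prod.snd = pullback.snd g h := by
    rw [Category.assoc, inv_prodComparison_map_snd]
    exact prod.lift_snd _ _
  have : Mono i := ⟨fun s t hst => by
    refine pullback.hom_ext ?_ ?_
    · rw [← hi₁, reassoc_of% hst]
    · rw [← hi₂, reassoc_of% hst]⟩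
  obtain ⟨Z, m, e, he, hem⟩ := hQ.exists_cover_subobject i
  refine ⟨Z, m ≫ prod.fst, m ≫ prod.snd, e, he, ?_, ?_⟩
  · rw [← hi₁, reassoc_of% hem, Q.map_comp]
  · rw [← hi₂, reassoc_of% hem, Q.map_comp]

theorem existsUnique_whiskerLeft_eq [Regular D] {B : Type a} [Category.{b} B] {P₁ : D ⥤ B}
    (hP₁ : IsRegularFunctor P₁) (P₂ : D ⥤ B) (α : Q ⋙ P₁ ⟶ Q ⋙ P₂) :
    ∃! β : P₁ ⟶ P₂, Functor.whiskerLeft Q β = α := by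
  have hlex := hP₁.lex
  have hepi : ∀ {F G : D} (g : F ⟶ G) [IsRegularEpi g], IsRegularEpi (P₁.map g) :=
    fun g hg => hP₁.regularEpi g hg
  have hα : ∀ {X Y : C} (m : X ⟶ Y), P₁.map (Q.map m) ≫ α.app Y = α.app X ≫ P₂.map (Q.map m) :=
    fun m => α.naturality m
  choose X g hg using hQ.exists_cover
  -- `P₁` preserves the kernel pair of `g F` and the cover of it by `Q.obj Z`; after precomposing
  -- with that cover, naturality of `α` shows that the two composites agree, so the map descends.
  have hb : ∀ F, ∃ b : P₁.obj F ⟶ P₂.obj F, P₁.map (g F) ≫ b = α.app (X F) ≫ P₂.map (g F) := by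
    intro F
    have := hepi (g F)
    obtain ⟨Z, m, n, e, he, hm, hn⟩ := hQ.exists_cover_pullback (g F) (g F)
    have := hepi e
    have hk : P₁.map (pullback.fst (g F) (g F)) ≫ α.app (X F) ≫ P₂.map (g F) =
        P₁.map (pullback.snd (g F) (g F)) ≫ α.app (X F) ≫ P₂.map (g F) := by
      rw [← cancel_epi (P₁.map e), ← P₁.map_comp_assoc, ← P₁.map_comp_assoc, hm, hn,
        reassoc_of% hα, reassoc_of% hα, ← P₂.map_comp, ← P₂.map_comp, ← hm, ← hn]
      simp [pullback.condition]
    have hp := (IsPullback.of_hasPullback (g F) (g F)).map P₁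
    obtain ⟨b, hb⟩ := Cofork.IsColimit.desc' (IsRegularEpi.isColimit (P₁.map (g F)))
      (α.app (X F) ≫ P₂.map (g F)) (by
        rw [← hp.lift_fst _ _ (IsRegularEpi.w (P₁.map (g F))), Category.assoc, hk,
          hp.lift_snd_assoc])
    exact ⟨b, hb⟩
  choose b hb using hb
  -- Compatibility of `b F` with every `h`, not only the chosen cover: compare the two on a cover of
  -- their pullback. With `h = g F ≫ k` it gives naturality, with `h = 𝟙` that `β` restricts to `α`.
  have key : ∀ {Y : C} {F : D} (h : Q.obj Y ⟶ F), P₁.map h ≫ b F = α.app Y ≫ P₂.map h := by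
    intro Y F h
    obtain ⟨Z, m, n, e, he, hm, hn⟩ := hQ.exists_cover_pullback h (g F)
    have := hepi e
    have := hepi (pullback.fst h (g F))
    rw [← cancel_epi (P₁.map (pullback.fst h (g F))), ← cancel_epi (P₁.map e),
      ← P₁.map_comp_assoc _ h, pullback.condition, P₁.map_comp_assoc, hb, ← P₁.map_comp_assoc,
      hn, ← P₁.map_comp_assoc, hm, reassoc_of% hα, reassoc_of% hα, ← P₂.map_comp, ← P₂.map_comp,
      ← hm, ← hn]
    simp [pullback.condition]
  refine ⟨{ app := b, naturality := fun F G k => ?_ }, ?_, fun β hβ => ?_⟩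
  · have := hepi (g F)
    rw [← cancel_epi (P₁.map (g F)), ← P₁.map_comp_assoc, key, reassoc_of% hb, P₂.map_comp]
  · ext Y
    simpa using key (𝟙 (Q.obj Y))
  · ext F
    have := hepi (g F)
    rw [← cancel_epi (P₁.map (g F))]
    dsimp only
    rw [hb, ← hβ, β.naturality]
    rfl

end IsCovering

end

/-! ### Reduced products along a directed poset -/

section
variable {M : Type a} [Category.{u} M] [HasProducts.{u} M] {J : Type u} [PartialOrder J]

/-- The diagram of the products of the tails of a family. -/
noncomputable def tailProd (U : J → M) : J ⥤ M where
  obj j := ∏ᶜ fun k : Set.Ici j => U k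
  map {i j} f := Pi.lift fun k : Set.Ici j =>
    Pi.π (fun k : Set.Ici i => U k) ⟨k.1, (leOfHom f).trans k.2⟩

/-- The projections from the product of a tail. -/
noncomputable def tailProdπ (U : J → M) {j k : J} (h : j ≤ k) : (tailProd U).obj j ⟶ U k :=
  Pi.π (fun k : Set.Ici j => U k) ⟨k, h⟩

@[simp]
theorem tailProd_map_π (U : J → M) {i j k : J} (f : i ⟶ j) (h : j ≤ k) :
    (tailProd U).map f ≫ tailProdπ U h = tailProdπ U ((leOfHom f).trans h) :=
  Pi.lift_π ..

/-- The product of a tail is a product. -/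
noncomputable def tailProdIsLimit (U : J → M) (j : J) :
    IsLimit (Fan.mk ((tailProd U).obj j) fun k : Set.Ici j => tailProdπ U k.2) :=
  productIsProduct _

theorem tailProd_ext {U : J → M} {j : J} {X : M} {f g : X ⟶ (tailProd U).obj j}
    (h : ∀ k (hk : j ≤ k), f ≫ tailProdπ U hk = g ≫ tailProdπ U hk) : f = g :=
  (tailProdIsLimit U j).hom_ext fun k => h _ k.as.2

/-- The components of `tailProdMap`. -/
noncomputable def tailProdMapApp {U V : J → M} (h : ∀ j, U j ⟶ V j) (j : J) :
    (tailProd U).obj j ⟶ (tailProd V).obj j :=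
  Pi.lift fun k : Set.Ici j => tailProdπ U k.2 ≫ h k

@[simp]
theorem tailProdMapApp_π {U V : J → M} (h : ∀ j, U j ⟶ V j) {j k : J} (hk : j ≤ k) :
    tailProdMapApp h j ≫ tailProdπ V hk = tailProdπ U hk ≫ h k :=
  Pi.lift_π ..

/-- The functoriality of `tailProd` in the family. -/
noncomputable def tailProdMap {U V : J → M} (h : ∀ j, U j ⟶ V j) : tailProd U ⟶ tailProd V where
  app j := tailProdMapApp h j
  naturality i j f := tailProd_ext fun k hk => by
    rw [Category.assoc, Category.assoc, tailProd_map_π, tailProdMapApp_π, tailProdMapApp_π,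
      ← Category.assoc, tailProd_map_π]

variable {K : Type w} [Category.{u} K] (ι : M ⥤ K)
  [∀ I : Type u, PreservesLimitsOfShape (Discrete I) ι]

/-- The image of the product of a tail is a product. -/
noncomputable def tailProdMapIsLimit (U : J → M) (j : J) :
    IsLimit (Fan.mk (ι.obj ((tailProd U).obj j)) fun k : Set.Ici j => ι.map (tailProdπ U k.2)) :=
  isLimitOfHasProductOfPreservesLimit ι (fun k : Set.Ici j => U k)

variable {ι} {C : J ⥤ K} {U : J → M} (β : ∀ j, C.obj j ⟶ ι.obj (U j))

/-- The morphism to the product of a tail given by a family of morphisms. -/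
noncomputable def toTailProd (j : J) : C.obj j ⟶ ι.obj ((tailProd U).obj j) :=
  (tailProdMapIsLimit ι U j).lift (Fan.mk _ fun k : Set.Ici j => C.map (homOfLE k.2) ≫ β k)

@[simp]
theorem toTailProd_π {j k : J} (h : j ≤ k) :
    toTailProd β j ≫ ι.map (tailProdπ U h) = C.map (homOfLE h) ≫ β k :=
  (tailProdMapIsLimit ι U j).fac _ ⟨⟨k, h⟩⟩

theorem toTailProd_π_assoc {j k : J} (h : j ≤ k) {Z : K} (f : ι.obj (U k) ⟶ Z) :
    toTailProd β j ≫ ι.map (tailProdπ U h) ≫ f = C.map (homOfLE h) ≫ β k ≫ f := by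
  rw [← Category.assoc, toTailProd_π, Category.assoc]

theorem tailProd_hom_ext {j : J} {X : K} {f g : X ⟶ ι.obj ((tailProd U).obj j)}
    (h : ∀ k (hk : j ≤ k), f ≫ ι.map (tailProdπ U hk) = g ≫ ι.map (tailProdπ U hk)) : f = g :=
  (tailProdMapIsLimit ι U j).hom_ext fun k => h _ k.as.2

theorem toTailProd_naturality {i j : J} (f : i ⟶ j) :
    C.map f ≫ toTailProd β j = toTailProd β i ≫ ι.map ((tailProd U).map f) := by
  refine tailProd_hom_ext fun k hk => ?_
  rw [Category.assoc, Category.assoc, ← ι.map_comp, tailProd_map_π, toTailProd_π, toTailProd_π,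
    ← C.map_comp_assoc]
  rfl

variable [HasColimitsOfShape J M] [ι.Full] {P : M} (p : ColimitPresentation J (ι.obj P))

variable (U) in
/-- The structure morphisms of a reduced product. -/
noncomputable def reducedι (j : J) : (tailProd U).obj j ⟶ colimit (tailProd U) :=
  colimit.ι (tailProd U) j

theorem tailProd_map_reducedι (U : J → M) {i j : J} (f : i ⟶ j) :
    (tailProd U).map f ≫ reducedι U j = reducedι U i :=
  colimit.w _ f

theorem reducedι_colimMap {U V : J → M} (h : ∀ j, U j ⟶ V j) (j : J) :
    reducedι U j ≫ colimMap (tailProdMap h) = tailProdMapApp h j ≫ reducedι V j :=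
  ι_colimMap _ _

/-- The morphism to a reduced product from a directed colimit, given by a family of morphisms. -/
theorem exists_toReduced {U : J → M} (β : ∀ j, p.diag.obj j ⟶ ι.obj (U j)) :
    ∃ f : P ⟶ colimit (tailProd U), ∀ j,
      p.ι.app j ≫ ι.map f = toTailProd β j ≫ ι.map (reducedι U j) := by
  let c : Cocone p.diag :=
    { pt := ι.obj (colimit (tailProd U))
      ι :=
        { app := fun j => toTailProd β j ≫ ι.map (reducedι U j)
          naturality := fun i j f => by
            refine Eq.trans ?_ (Category.comp_id _).symm
            rw [← Category.assoc, toTailProd_naturality, Category.assoc, ← ι.map_comp,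
              tailProd_map_reducedι] } }
  refine ⟨ι.preimage (p.isColimit.desc c), fun j => ?_⟩
  rw [ι.map_preimage]
  exact p.isColimit.fac c j

variable [IsDirectedOrder J] [Nonempty J] {F : M ⥤ Type u} (hF : IsInterpretation M F)
include hF

/-- Elements with the same image in the colimit already agree in some tail product, hence in all its
coordinates. -/
theorem exists_forall_eq_of_reduced {i j : J} (y : F.obj ((tailProd U).obj i))
    (z : F.obj ((tailProd U).obj j)) (h : F.map (reducedι U i) y = F.map (reducedι U j) z) :
    ∃ (k : J) (hi : i ≤ k) (hj : j ≤ k), ∀ l (hl : k ≤ l),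
      F.map (tailProdπ U (hi.trans hl)) y = F.map (tailProdπ U (hj.trans hl)) z := by
  obtain ⟨k, hi, hj⟩ := exists_ge_ge i j
  obtain ⟨l, f, hl⟩ := hF.exists_map_eq (colimit.isColimit (tailProd U))
    (x := F.map ((tailProd U).map (homOfLE hi)) y) (y := F.map ((tailProd U).map (homOfLE hj)) z) (by
      have e : ∀ {i} (g : i ⟶ k) (t : F.obj ((tailProd U).obj i)),
          F.map (reducedι U k) (F.map ((tailProd U).map g) t) = F.map (reducedι U i) t :=
        fun g t => by rw [← comp_apply, ← Functor.map_comp, tailProd_map_reducedι]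
      exact (e (homOfLE hi) y).trans (h.trans (e (homOfLE hj) z).symm))
  refine ⟨l, hi.trans (leOfHom f), hj.trans (leOfHom f), fun m hm => ?_⟩
  have := congrArg (F.map (tailProdπ U hm)) hl
  simpa only [← comp_apply, ← Functor.map_comp, tailProd_map_π] using this

variable [ι.Faithful] (x : F.obj P)

/-- The germ at `x` of a family of morphisms, natural in the family. -/
theorem exists_germ (β : ∀ j, p.diag.obj j ⟶ ι.obj (U j)) :
    ∃ (i : J) (y : ∀ k, i ≤ k → F.obj (U k)),
      (∀ {V : J → M} (h g : ∀ j, U j ⟶ V j), (∀ j, β j ≫ ι.map (h j) = β j ≫ ι.map (g j)) →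
        ∃ k, i ≤ k ∧ ∀ l (_ : k ≤ l) (hi : i ≤ l),
          F.map (h l) (y l hi) = F.map (g l) (y l hi)) ∧
      ∀ h : ∀ j, U j ⟶ P, (∀ j, β j ≫ ι.map (h j) = p.ι.app j) →
        ∃ k, i ≤ k ∧ ∀ l (_ : k ≤ l) (hi : i ≤ l), F.map (h l) (y l hi) = x := by
  obtain ⟨f, hf⟩ := exists_toReduced p β
  obtain ⟨i, y, hy⟩ := hF.exists_rep (colimit.isColimit (tailProd U)) (F.map f x)
  have hy' : ∀ {V : J → M} (h : ∀ j, U j ⟶ V j),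
      F.map (reducedι V i) (F.map (tailProdMapApp h i) y) =
        F.map (f ≫ colimMap (tailProdMap h)) x := fun {V} h => by
    have : tailProdMapApp h i ≫ reducedι V i = reducedι U i ≫ colimMap (tailProdMap h) :=
      (reducedι_colimMap _ _).symm
    rw [← comp_apply, ← Functor.map_comp, this, Functor.map_comp, Functor.map_comp]
    exact congrArg (F.map (colimMap (tailProdMap h))) hy
  have hf' : ∀ {V : J → M} (h : ∀ j, U j ⟶ V j) j,
      p.ι.app j ≫ ι.map (f ≫ colimMap (tailProdMap h)) =
        toTailProd β j ≫ ι.map (tailProdMapApp h j) ≫ ι.map (reducedι V j) := fun h j => by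
    rw [ι.map_comp, reassoc_of% hf, ← ι.map_comp, ← ι.map_comp, reducedι_colimMap]
  refine ⟨i, fun k hk => F.map (tailProdπ U hk) y, fun {V} h g hhg => ?_, fun h hh => ?_⟩
  -- The two induced maps agree on every stage of the colimit `P`, so they are equal and the two
  -- image germs of `y` coincide.
  · have e : f ≫ colimMap (tailProdMap h) = f ≫ colimMap (tailProdMap g) := by
      refine ι.map_injective (p.isColimit.hom_ext fun j => ?_)
      refine (hf' h j).trans (Eq.trans ?_ (hf' g j).symm)
      rw [← Category.assoc, ← Category.assoc]
      refine congrArg (· ≫ _) (tailProd_hom_ext fun k hk => ?_)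
      simp only [Category.assoc, ← ι.map_comp, tailProdMapApp_π]
      simp only [ι.map_comp, toTailProd_π_assoc, hhg]
    obtain ⟨k, hk, _, h'⟩ := exists_forall_eq_of_reduced hF _ _
      ((hy' h).trans ((congrArg (fun φ => F.map φ x) e).trans (hy' g).symm))
    refine ⟨k, hk, fun l hl hi => ?_⟩
    simpa only [← comp_apply, ← Functor.map_comp, tailProdMapApp_π] using h' l hl
  -- Here the induced map from `P` to its reduced power is the diagonal, so the image germ of `y` is
  -- eventually constant at `x`.
  · let δ : P ⟶ (tailProd fun _ : J => P).obj i := Pi.lift fun _ => 𝟙 P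
    have hδ : ∀ {l} (hl : i ≤ l), δ ≫ tailProdπ (fun _ : J => P) hl = 𝟙 P := fun hl =>
      Pi.lift_π _ _
    have e : f ≫ colimMap (tailProdMap h) = δ ≫ reducedι (fun _ : J => P) i := by
      refine ι.map_injective (p.isColimit.hom_ext fun j => ?_)
      refine (hf' h j).trans ?_
      obtain ⟨k, hi, hj⟩ := exists_ge_ge i j
      rw [← tailProd_map_reducedι _ (homOfLE hi), ← tailProd_map_reducedι _ (homOfLE hj)]
      simp only [ι.map_comp, ← Category.assoc]
      refine congrArg (· ≫ _) (tailProd_hom_ext fun l hl => ?_)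
      have := p.w (homOfLE (hj.trans hl))
      simp only [Category.assoc, ← ι.map_comp, tailProd_map_π, hδ, tailProdMapApp_π]
      simp only [ι.map_comp, toTailProd_π_assoc, hh, ι.map_id, this]
      exact (Category.comp_id _).symm
    obtain ⟨k, hk, _, h'⟩ := exists_forall_eq_of_reduced hF _ (F.map δ x)
      ((hy' h).trans ((congrArg (fun φ => F.map φ x) e).trans (by simp)))
    refine ⟨k, hk, fun l hl hi => ?_⟩
    have := h' l hl
    rw [← comp_apply, ← comp_apply, ← Functor.map_comp, ← Functor.map_comp, hδ,
      tailProdMapApp_π] at this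
    simpa using this

end

/-! ### Interpretations and finitely presentable objects -/

/-- A functor preserves small products and colimits of small directed diagrams. -/
class PreservesProductsAndDirectedColimits {K : Type w} [Category.{u} K] {M : Type a}
    [Category.{u} M] (ι : M ⥤ K) : Prop where
  products (I : Type u) : PreservesLimitsOfShape (Discrete I) ι
  directedColimits (I : Type u) [PartialOrder I] [IsDirectedOrder I] [Nonempty I] :
    PreservesColimitsOfShape I ι

attribute [instance] PreservesProductsAndDirectedColimits.products
  PreservesProductsAndDirectedColimits.directedColimits

section
variable {K : Type w} [Category.{u} K] {M : Type a} [Category.{u} M] (ι : M ⥤ K)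
  [PreservesProductsAndDirectedColimits ι]

theorem IsInterpretation.comp {F : K ⥤ Type u} (hF : IsInterpretation K F) :
    IsInterpretation M (ι ⋙ F) :=
  ⟨fun J => have := hF.1 J; inferInstance, fun J _ _ _ => have := hF.2 J; inferInstance⟩

theorem isInterpretation_coyoneda (C : K) [IsFinitelyPresentable.{u} C] :
    IsInterpretation K (coyoneda.obj (op C)) :=
  ⟨fun _ => inferInstance, fun _ _ _ _ => inferInstance⟩

/-- The interpretation corepresented by a finitely presentable object. -/
def reprPlus (C : K) [IsFinitelyPresentable.{u} C] : Plus M :=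
  ⟨ι ⋙ coyoneda.obj (op C), (isInterpretation_coyoneda C).comp ι⟩

/-- The element of `reprPlus` given by a morphism. -/
def reprMk {C : K} [IsFinitelyPresentable.{u} C] {N : M} (b : C ⟶ ι.obj N) :
    (reprPlus ι C).obj.obj N := b

theorem exists_reprMk {C : K} [IsFinitelyPresentable.{u} C] {N : M}
    (y : (reprPlus ι C).obj.obj N) : ∃ b : C ⟶ ι.obj N, y = reprMk ι b := ⟨y, rfl⟩

theorem reprMk_map {C : K} [IsFinitelyPresentable.{u} C] {N N' : M} (b : C ⟶ ι.obj N)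
    (h : N ⟶ N') : (reprPlus ι C).obj.map h (reprMk ι b) = reprMk ι (b ≫ ι.map h) := rfl

/-- Precomposition, as a morphism of corepresented interpretations. -/
def reprMap {C D : K} [IsFinitelyPresentable.{u} C] [IsFinitelyPresentable.{u} D] (f : C ⟶ D) :
    reprPlus ι D ⟶ reprPlus ι C :=
  ObjectProperty.homMk (Functor.whiskerLeft ι (coyoneda.map f.op))

theorem reprMap_app {C D : K} [IsFinitelyPresentable.{u} C] [IsFinitelyPresentable.{u} D]
    (f : C ⟶ D) {N : M} (b : D ⟶ ι.obj N) :
    (reprMap ι f).hom.app N (reprMk ι b) = reprMk ι (f ≫ b) := rfl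

theorem natural_reprMk {C : K} [IsFinitelyPresentable.{u} C] {F : Plus M} (ν : reprPlus ι C ⟶ F)
    {N N' : M} (b : C ⟶ ι.obj N) (h : N ⟶ N') :
    ν.hom.app N' (reprMk ι (b ≫ ι.map h)) = F.obj.map h (ν.hom.app N (reprMk ι b)) :=
  Plus.naturality ν h (reprMk ι b)

/-- A small family of objects that determines the interpretations. -/
structure IsTestFamily {T : Type u} (N : T → M) : Prop where
  exists_elem {F : M ⥤ Type u} (hF : IsInterpretation M F) {X : M} (x : F.obj X) :
    ∃ (t : T) (g : N t ⟶ X) (y : F.obj (N t)), F.map g y = x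
  exists_mono {X : M} {s t : T} (f : N s ⟶ X) (g : N t ⟶ X) :
    ∃ (r : T) (i : N r ⟶ X) (f' : N s ⟶ N r) (g' : N t ⟶ N r),
      Mono (ι.map i) ∧ f' ≫ i = f ∧ g' ≫ i = g

variable {ι} in
theorem IsTestFamily.exists_hom {T : Type u} {N : T → M} (hN : IsTestFamily ι N) (C : K)
    [IsFinitelyPresentable.{u} C] {X : M} (b : C ⟶ ι.obj X) :
    ∃ (t : T) (g : N t ⟶ X) (b' : C ⟶ ι.obj (N t)), b' ≫ ι.map g = b :=
  hN.exists_elem (reprPlus ι C).property (reprMk ι b)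

variable [HasProducts.{u} M]

omit [PreservesProductsAndDirectedColimits ι] in
variable {ι} in
-- `P` is the product of one copy of `N t` for each element of `F.obj.obj (N t)`, and `x` is the
-- tuple of all these elements.
theorem IsTestFamily.exists_generic {T : Type u} {N : T → M} (hN : IsTestFamily ι N) (F : Plus M) :
    ∃ (P : M) (x : F.obj.obj P), ∀ (X : M) (y : F.obj.obj X), ∃ f : P ⟶ X, F.obj.map f x = y := by
  let U : (Σ t, F.obj.obj (N t)) → M := fun q => N q.1
  obtain ⟨x, hx, -⟩ := F.property.existsUnique (productIsProduct U) fun q => q.2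
  refine ⟨∏ᶜ U, x, fun X y => ?_⟩
  obtain ⟨t, g, z, rfl⟩ := hN.exists_elem F.property y
  refine ⟨Pi.π U ⟨t, z⟩ ≫ g, ?_⟩
  rw [Functor.map_comp]
  exact congrArg (F.obj.map g) (hx ⟨t, z⟩)

section
variable [ι.Full] [ι.Faithful] {J : Type u} [PartialOrder J] [IsDirectedOrder J] [Nonempty J]
  [HasColimitsOfShape J M] {P : M} (p : ColimitPresentation J (ι.obj P))

/-- The bound `k` of `exists_germ` depends on the equation; packing all equations at stage `j` into
one map to `∏ᶜ V j` yields a common bound. -/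
theorem exists_germ_of_families {F : M ⥤ Type u} (hF : IsInterpretation M F) (x : F.obj P)
    {U : J → M} (β : ∀ j, p.diag.obj j ⟶ ι.obj (U j)) :
    ∃ (i : J) (y : ∀ k, i ≤ k → F.obj (U k)),
      (∀ {I : J → Type u} {V : ∀ j, I j → M} (h g : ∀ j q, U j ⟶ V j q),
        (∀ j q, β j ≫ ι.map (h j q) = β j ≫ ι.map (g j q)) →
        ∃ k, i ≤ k ∧ ∀ l (_ : k ≤ l) (hi : i ≤ l) q,
          F.map (h l q) (y l hi) = F.map (g l q) (y l hi)) ∧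
      ∀ h : ∀ j, U j ⟶ P, (∀ j, β j ≫ ι.map (h j) = p.ι.app j) →
        ∃ k, i ≤ k ∧ ∀ l (_ : k ≤ l) (hi : i ≤ l), F.map (h l) (y l hi) = x := by
  obtain ⟨i, y, hy, hy'⟩ := exists_germ p hF x β
  refine ⟨i, y, fun {I V} h g hhg => ?_, hy'⟩
  have hπ : ∀ (h : ∀ j q, U j ⟶ V j q) j q, Pi.lift (h j) ≫ Pi.π (V j) q = h j q :=
    fun h j q => Pi.lift_π _ _
  obtain ⟨k, hk, H⟩ := hy (V := fun j => ∏ᶜ V j) (fun j => Pi.lift (h j))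
    (fun j => Pi.lift (g j)) (fun j =>
      (isLimitOfHasProductOfPreservesLimit ι (V j)).hom_ext fun ⟨q⟩ => by
        change (_ ≫ _) ≫ ι.map (Pi.π (V j) q) = (_ ≫ _) ≫ ι.map (Pi.π (V j) q)
        rw [Category.assoc, Category.assoc, ← ι.map_comp, ← ι.map_comp, hπ, hπ, hhg])
  refine ⟨k, hk, fun l hl hi q => ?_⟩
  have := congrArg (F.map (Pi.π (V l) q)) (H l hl hi)
  rwa [← comp_apply, ← comp_apply, ← Functor.map_comp, ← Functor.map_comp, hπ, hπ] at this

/-- Take `U j` to be the product of `P` with a copy of `N t` for every `b : p.diag.obj j ⟶ ι.obj (N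
t)`. The value of `v` at `b` is the `b`-th coordinate of a germ at `x`, read at a stage so late that
all the required equations hold. -/
theorem exists_natural_on_family {F : M ⥤ Type u} (hF : IsInterpretation M F) (x : F.obj P)
    {T : Type u} (N : T → M) :
    ∃ (i : J) (v : ∀ t, (p.diag.obj i ⟶ ι.obj (N t)) → F.obj (N t)),
      (∀ s t (h : N s ⟶ N t) b, v t (b ≫ ι.map h) = F.map h (v s b)) ∧
      ∀ t (g : N t ⟶ P) b, b ≫ ι.map g = p.ι.app i → F.map g (v t b) = x := by
  let W : ∀ j, Option (Σ t, (p.diag.obj j ⟶ ι.obj (N t))) → M := fun j o =>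
    o.elim P fun q => N q.1
  let β : ∀ j, p.diag.obj j ⟶ ι.obj (∏ᶜ W j) := fun j =>
    (isLimitOfHasProductOfPreservesLimit ι (W j)).lift (Fan.mk _ fun o =>
      match o with
      | none => p.ι.app j
      | some q => q.2)
  let π₀ : ∀ j, ∏ᶜ W j ⟶ P := fun j => Pi.π (W j) none
  let π : ∀ j t, (p.diag.obj j ⟶ ι.obj (N t)) → (∏ᶜ W j ⟶ N t) := fun j t b =>
    Pi.π (W j) (some ⟨t, b⟩)
  have hβ₀ : ∀ j, β j ≫ ι.map (π₀ j) = p.ι.app j := fun j =>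
    (isLimitOfHasProductOfPreservesLimit ι (W j)).fac _ ⟨none⟩
  have hβ : ∀ j t b, β j ≫ ι.map (π j t b) = b := fun j t b =>
    (isLimitOfHasProductOfPreservesLimit ι (W j)).fac _ ⟨some ⟨t, b⟩⟩
  obtain ⟨i, y, hy, hy'⟩ := exists_germ_of_families ι p hF x β
  -- Three eventual facts: the `P`-coordinate of the germ is `x`; coordinates are natural in `N t`;
  -- a coordinate lying over the coprojection to `P` maps to the `P`-coordinate.
  obtain ⟨k₀, hk₀, h₀⟩ := hy' π₀ hβ₀
  obtain ⟨k₁, hk₁, h₁⟩ := hy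
    (I := fun j => Σ (s : T) (t : T), (N s ⟶ N t) × (p.diag.obj j ⟶ ι.obj (N s)))
    (V := fun j q => N q.2.1)
    (fun j q => π j q.1 q.2.2.2 ≫ q.2.2.1)
    (fun j q => π j q.2.1 (q.2.2.2 ≫ ι.map q.2.2.1))
    (fun j q => by rw [ι.map_comp, ← Category.assoc, hβ, hβ])
  obtain ⟨k₂, hk₂, h₂⟩ := hy
    (I := fun j => Σ t, { q : (N t ⟶ P) × (p.diag.obj j ⟶ ι.obj (N t)) //
      q.2 ≫ ι.map q.1 = p.ι.app j })
    (V := fun j q => P)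
    (fun j q => π j q.1 q.2.1.2 ≫ q.2.1.1)
    (fun j q => π₀ j)
    (fun j q => by rw [ι.map_comp, ← Category.assoc, hβ, hβ₀, q.2.2])
  obtain ⟨k, hk, hk'⟩ := exists_ge_ge k₀ k₁
  obtain ⟨l, hl, hl'⟩ := exists_ge_ge k k₂
  have hi : i ≤ l := hk₂.trans hl'
  refine ⟨l, fun t b => F.map (π l t b) (y l hi), fun s t h b => ?_, fun t g b hb => ?_⟩
  · rw [← comp_apply, ← Functor.map_comp]
    exact (h₁ l (hk'.trans hl) hi ⟨s, t, h, b⟩).symm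
  · rw [← comp_apply, ← Functor.map_comp]
    exact (h₂ l hl' hi ⟨t, (g, b), hb⟩).trans (h₀ l (hk.trans hl) hi)

variable [∀ j, IsFinitelyPresentable.{u} (p.diag.obj j)]

variable {ι} in
-- Every `C ⟶ ι.obj X` with `C` finitely presentable factors through a test object, so the natural
-- family on test objects extends to all of `M`.
theorem IsTestFamily.exists_reprPlus_hom {T : Type u} {N : T → M} (hN : IsTestFamily ι N)
    (F : Plus M) (x : F.obj.obj P) :
    ∃ (i : J) (ν : reprPlus ι (p.diag.obj i) ⟶ F), ν.hom.app P (reprMk ι (p.ι.app i)) = x := by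
  obtain ⟨i, v, hv, hv'⟩ := exists_natural_on_family ι p F.property x N
  obtain ⟨ν, hν⟩ := Plus.exists_hom_of_existsUnique (F := reprPlus ι (p.diag.obj i)) (G := F)
    (fun X b y => ∃ (t : T) (g : N t ⟶ X) (b' : p.diag.obj i ⟶ ι.obj (N t)),
      reprMk ι (b' ≫ ι.map g) = b ∧ F.obj.map g (v t b') = y)
    (fun X b => by
      obtain ⟨t, g, b', hb⟩ := hN.exists_hom (p.diag.obj i) (X := X) b
      refine ⟨_, ⟨t, g, b', hb, rfl⟩, ?_⟩
      rintro _ ⟨s, f, b'', hb', rfl⟩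
      -- Independence of the factorization: both pass through one test object that is a subobject of
      -- `X`, where the two maps from `p.diag.obj i` already agree.
      obtain ⟨r, m, f', g', hm, rfl, rfl⟩ := hN.exists_mono f g
      have : b'' ≫ ι.map f' = b' ≫ ι.map g' := by
        rw [← cancel_mono (ι.map m), Category.assoc, Category.assoc, ← ι.map_comp,
          ← ι.map_comp]
        exact hb'.trans hb.symm
      rw [Functor.map_comp, Functor.map_comp]
      refine congrArg (F.obj.map m) ?_
      change F.obj.map f' (v s b'') = F.obj.map g' (v t b')
      rw [← hv, ← hv, this])
    (by
      rintro X Y f _ _ ⟨t, g, b', rfl, rfl⟩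
      refine ⟨t, g ≫ f, b', ?_, by rw [Functor.map_comp]; rfl⟩
      rw [reprMk_map, ι.map_comp, Category.assoc])
  refine ⟨i, ν, ?_⟩
  obtain ⟨t, g, b, hb, h⟩ := hν P (reprMk ι (p.ι.app i))
  exact h.symm.trans (hv' t g b hb)

omit [ι.Faithful] in
-- Otherwise every stage `k ≥ i` has a counterexample `β k` with values in some `U k`. In the
-- reduced product of the `U k` the equality at `P` forces agreement at late stages, a
-- contradiction.
theorem exists_eq_of_app_eq {F : Plus M} {i : J} (ν ν' : reprPlus ι (p.diag.obj i) ⟶ F)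
    (h : ν.hom.app P (reprMk ι (p.ι.app i)) = ν'.hom.app P (reprMk ι (p.ι.app i))) :
    ∃ (k : J) (f : i ⟶ k), reprMap ι (p.diag.map f) ≫ ν = reprMap ι (p.diag.map f) ≫ ν' := by
  by_contra! hne
  have : ∀ k, ∃ (X : M) (b : p.diag.obj k ⟶ ι.obj X), ∀ f : i ⟶ k,
      ν.hom.app X (reprMk ι (p.diag.map f ≫ b)) ≠ ν'.hom.app X (reprMk ι (p.diag.map f ≫ b)) := by
    intro k
    by_cases hk : Nonempty (i ⟶ k)
    · obtain ⟨f⟩ := hk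
      by_contra! hk
      refine hne k f (Plus.hom_ext fun X b => ?_)
      obtain ⟨f', hf'⟩ := hk X b
      obtain rfl : f = f' := Subsingleton.elim _ _
      exact hf'
    -- A dummy value for `k` not above `i`.
    · exact ⟨P, p.ι.app k, fun f => (hk ⟨f⟩).elim⟩
  choose U β hβ using this
  obtain ⟨f, hf⟩ := exists_toReduced p β
  have key : ∀ η : reprPlus ι (p.diag.obj i) ⟶ F,
      F.obj.map f (η.hom.app P (reprMk ι (p.ι.app i))) =
        F.obj.map (reducedι U i) (η.hom.app _ (reprMk ι (toTailProd β i))) := fun η => by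
    rw [← natural_reprMk, ← natural_reprMk, hf]
  obtain ⟨k, hi, _, h'⟩ := exists_forall_eq_of_reduced F.property _ _
    ((key ν).symm.trans ((congrArg (F.obj.map f) h).trans (key ν')))
  have := h' k le_rfl
  rw [← natural_reprMk, ← natural_reprMk, toTailProd_π] at this
  exact hβ k (homOfLE hi) this

end
end

/-! ### Coverings by corepresented interpretations -/

/-- A category has colimits of small directed diagrams. -/
class HasDirectedColimits (M : Type a) [Category.{u} M] : Prop where
  hasColimitsOfShape (I : Type u) [PartialOrder I] [IsDirectedOrder I] [Nonempty I] :
    HasColimitsOfShape I M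

attribute [instance] HasDirectedColimits.hasColimitsOfShape

section
variable {K : Type w} [Category.{u} K] {M : Type a} [Category.{u} M] {ι : M ⥤ K}
  [PreservesProductsAndDirectedColimits ι]

theorem Plus.map_comp_apply (F : Plus K) {X Y Z : K} (f : X ⟶ Y) (g : Y ⟶ Z) (x : F.obj.obj X) :
    F.obj.map (f ≫ g) x = F.obj.map g (F.obj.map f x) := by
  rw [Functor.map_comp, comp_apply]

/-- The Yoneda morphism to the restriction of an interpretation. -/
def reprHom {C : K} [IsFinitelyPresentable.{u} C] {X : Plus K} (z : X.obj.obj C) :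
    reprPlus ι C ⟶ ⟨ι ⋙ X.obj, X.property.comp ι⟩ :=
  ObjectProperty.homMk
    { app := fun N => TypeCat.ofHom fun b : C ⟶ ι.obj N => X.obj.map b z
      naturality := fun N N' f => by
        ext b
        exact X.map_comp_apply b (ι.map f) z }

variable (ι) in
theorem reprHom_app {C : K} [IsFinitelyPresentable.{u} C] {X : Plus K} (z : X.obj.obj C) {N : M}
    (b : C ⟶ ι.obj N) : (reprHom (ι := ι) z).hom.app N (reprMk ι b) = X.obj.map b z := rfl

variable [IsLocallyFinitelyPresentable.{u} K] [HasProducts.{u} M] [HasDirectedColimits M] [ι.Full] [ι.Faithful] {T : Type u} {N : T → M}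
  (hN : IsTestFamily ι N)
include hN

/-- A transformation that hits a generic element is pointwise surjective. -/
theorem IsTestFamily.exists_cover (F : Plus M) :
    ∃ (C : K) (_ : IsFinitelyPresentable.{u} C) (ν : reprPlus ι C ⟶ F),
      ∀ X, Function.Surjective (ν.hom.app X) := by
  obtain ⟨P, x, hx⟩ := hN.exists_generic F
  obtain ⟨J, _, _, _, p, hp⟩ := exists_directed_presentation (ι.obj P)
  obtain ⟨i, ν, hν⟩ := hN.exists_reprPlus_hom p F x
  refine ⟨_, _, ν, fun X y => ?_⟩
  obtain ⟨f, rfl⟩ := hx X y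
  exact ⟨reprMk ι (p.ι.app i ≫ ι.map f),
    (natural_reprMk ι ν _ f).trans (congrArg (F.obj.map f) hν)⟩

/-- `X` preserves the directed colimit `ι.obj P` in `K`, so the image of the generic element comes
from some `z` at a finitely presentable stage. The composite of the cover with `j` and the Yoneda
map of `z` agree at the generic element, hence coincide at a later stage. -/
theorem IsTestFamily.exists_cover_of_hom {X : Plus K} {W : Plus M}
    (j : W ⟶ ⟨ι ⋙ X.obj, X.property.comp ι⟩) :
    ∃ (C : K) (_ : IsFinitelyPresentable.{u} C) (z : X.obj.obj C) (e : reprPlus ι C ⟶ W),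
      (∀ Y, Function.Surjective (e.hom.app Y)) ∧ e ≫ j = reprHom z := by
  obtain ⟨P, x, hx⟩ := hN.exists_generic W
  obtain ⟨J, _, _, _, p, hp⟩ := exists_directed_presentation (ι.obj P)
  obtain ⟨i, ν, hν⟩ := hN.exists_reprPlus_hom p W x
  obtain ⟨i', z, hz⟩ := X.property.exists_rep p.isColimit (j.hom.app P x)
  obtain ⟨k, hi, hi'⟩ := exists_ge_ge i i'
  obtain ⟨l, f, hf⟩ := exists_eq_of_app_eq ι p
    (reprMap ι (p.diag.map (homOfLE hi)) ≫ ν ≫ j)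
    (reprHom (X.obj.map (p.diag.map (homOfLE hi')) z)) (by
      refine Eq.trans (b := j.hom.app P x) ?_ (Eq.trans hz.symm ?_)
      · rw [← hν, ← p.w (homOfLE hi)]
        rfl
      · rw [reprHom_app, ← p.w (homOfLE hi')]
        exact X.map_comp_apply _ _ z)
  refine ⟨p.diag.obj l, hp l, X.obj.map (p.diag.map f) (X.obj.map (p.diag.map (homOfLE hi')) z),
    reprMap ι (p.diag.map f) ≫ reprMap ι (p.diag.map (homOfLE hi)) ≫ ν, fun Y y => ?_, ?_⟩
  · obtain ⟨g, rfl⟩ := hx Y y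
    refine ⟨reprMk ι (p.ι.app l ≫ ι.map g), ?_⟩
    rw [natural_reprMk]
    refine congrArg (W.obj.map g) (Eq.trans ?_ hν)
    rw [← p.w (homOfLE hi), ← p.w f]
    rfl
  · rw [Category.assoc, Category.assoc, hf]
    refine Plus.hom_ext fun Y b => ?_
    exact X.map_comp_apply (p.diag.map f) b _

/-! ### Smallness of `M⁺` -/

omit [PreservesProductsAndDirectedColimits ι] [HasProducts.{u} M] [HasDirectedColimits M]
  [ι.Full] [ι.Faithful] [IsLocallyFinitelyPresentable.{u} K] in
theorem IsTestFamily.locallySmall : LocallySmall.{u} (Plus M) where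
  hom_small F G := by
    refine small_of_injective (β := ∀ t, F.obj.obj (N t) → G.obj.obj (N t))
      (f := fun φ t x => φ.hom.app (N t) x) fun φ ψ h => Plus.hom_ext fun X x => ?_
    obtain ⟨t, g, y, rfl⟩ := hN.exists_elem F.property x
    rw [Plus.naturality, Plus.naturality]
    exact congrArg (G.obj.map g) (congrFun (congrFun h t) y)

omit [PreservesProductsAndDirectedColimits ι] [HasProducts.{u} M] [HasDirectedColimits M]
  [ι.Full] [ι.Faithful] [IsLocallyFinitelyPresentable.{u} K] in
-- The kernel pair of `ν` is itself an interpretation, so its elements come from test objects.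
theorem IsTestFamily.exists_desc {R F G : Plus M} {ν : R ⟶ F} {μ : R ⟶ G}
    (hν : ∀ X, Function.Surjective (ν.hom.app X))
    (h : ∀ t (x y : R.obj.obj (N t)), ν.hom.app _ x = ν.hom.app _ y →
      μ.hom.app _ x = μ.hom.app _ y) : ∃ d : F ⟶ G, ν ≫ d = μ := by
  refine Plus.exists_desc hν μ fun X x y hxy => ?_
  obtain ⟨r, rfl, rfl⟩ := Plus.exists_of_isPullback (IsPullback.of_hasPullback ν ν) x y hxy
  obtain ⟨t, g, r, rfl⟩ := hN.exists_elem (pullback ν ν).property r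
  simp only [Plus.naturality]
  refine congrArg (G.obj.map g) (h t _ _ ?_)
  exact congrArg (fun φ : pullback ν ν ⟶ F => φ.hom.app (N t) r) pullback.condition

omit [PreservesProductsAndDirectedColimits ι] [HasProducts.{u} M] [HasDirectedColimits M]
  [ι.Full] [ι.Faithful] [IsLocallyFinitelyPresentable.{u} K] in
theorem IsTestFamily.nonempty_iso {R F G : Plus M} {ν : R ⟶ F} {μ : R ⟶ G}
    (hν : ∀ X, Function.Surjective (ν.hom.app X)) (hμ : ∀ X, Function.Surjective (μ.hom.app X))
    (h : ∀ t (x y : R.obj.obj (N t)), ν.hom.app _ x = ν.hom.app _ y ↔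
      μ.hom.app _ x = μ.hom.app _ y) : Nonempty (F ≅ G) := by
  obtain ⟨d, hd⟩ := hN.exists_desc hν fun t x y => (h t x y).1
  obtain ⟨d', hd'⟩ := hN.exists_desc hμ fun t x y => (h t x y).2
  have := Plus.epi_of_surjective hν
  have := Plus.epi_of_surjective hμ
  exact ⟨⟨d, d', by rw [← cancel_epi ν, reassoc_of% hd, hd', Category.comp_id],
    by rw [← cancel_epi μ, reassoc_of% hd', hd, Category.comp_id]⟩⟩

/-- Up to isomorphism `F` is determined by the finitely presentable object covering it and the
kernel of that cover on test objects; such data form a small set. -/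
theorem IsTestFamily.essentiallySmall : EssentiallySmall.{u} (Plus M) := by
  refine (essentiallySmall_iff _).2 ⟨?_, hN.locallySmall⟩
  obtain ⟨S', S, hS, hS'⟩ := exists_small_family (ObjectProperty.isFinitelyPresentable.{u} K)
  have : ∀ s, IsFinitelyPresentable.{u} (S s) := hS
  have key : ∀ F : Plus M, ∃ (s : S') (ν : reprPlus ι (S s) ⟶ F),
      ∀ X, Function.Surjective (ν.hom.app X) := fun F => by
    obtain ⟨C, hC, ν, hν⟩ := hN.exists_cover F
    obtain ⟨s, ⟨e⟩⟩ := hS' C hC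
    refine ⟨s, reprMap ι e.hom ≫ ν, fun X y => ?_⟩
    obtain ⟨x, rfl⟩ := hν X y
    obtain ⟨b, hb⟩ := exists_reprMk ι x
    refine ⟨reprMk ι (e.inv ≫ b), ?_⟩
    refine congrArg (ν.hom.app X) ((reprMap_app ι e.hom _).trans ?_)
    rw [Iso.hom_inv_id_assoc]
    exact hb.symm
  choose s ν hν using key
  let f : Skeleton (Plus M) → Σ s : S', ∀ t, (S s ⟶ ι.obj (N t)) → (S s ⟶ ι.obj (N t)) → Prop :=
    fun F => ⟨s ((fromSkeleton _).obj F), fun t x y =>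
      (ν ((fromSkeleton _).obj F)).hom.app (N t) (reprMk ι x) =
        (ν ((fromSkeleton _).obj F)).hom.app (N t) (reprMk ι y)⟩
  refine small_of_injective (f := f) fun F G h => ?_
  have : ∀ F G : Plus M,
      (⟨s F, fun t x y => (ν F).hom.app (N t) (reprMk ι x) = (ν F).hom.app (N t) (reprMk ι y)⟩ :
        Σ s : S', ∀ t, (S s ⟶ ι.obj (N t)) → (S s ⟶ ι.obj (N t)) → Prop) =
      ⟨s G, fun t x y => (ν G).hom.app (N t) (reprMk ι x) = (ν G).hom.app (N t) (reprMk ι y)⟩ →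
      Nonempty (F ≅ G) := by
    intro F G h
    have hF := hν F
    have hG := hν G
    -- The kernel relations live over the index `s F`, so the indices must become variables before
    -- being identified.
    revert h hF hG
    generalize ν F = n
    generalize ν G = m
    generalize s F = i at n
    generalize s G = j at m
    intro h hF hG
    obtain rfl : i = j := congrArg Sigma.fst h
    refine hN.nonempty_iso hF hG fun t x y => ?_
    have := eq_of_heq (Sigma.mk.inj h).2
    exact iff_of_eq (congrFun (congrFun (congrFun this t) x) y)
  obtain ⟨e⟩ := this _ _ h
  exact skeleton_skeletal _ ⟨(fromSkeleton _).preimageIso e⟩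

end

/-! ### Definable subcategories -/

namespace IsDefinable

variable {K : Type w} [Category.{u} K] [IsLocallyFinitelyPresentable.{u} K] {L : ObjectProperty K}
  (hL : IsDefinable L)

omit [IsLocallyFinitelyPresentable.{u} K] in
variable (K) in
-- Lets smallness of `Plus K` be deduced from the definable case.
theorem top : IsDefinable (⊤ : ObjectProperty K) where
  products _ := ⟨fun _ _ => trivial⟩
  directedColimits _ _ _ _ := ⟨fun _ _ => trivial⟩
  pureSubobjects _ _ _ _ _ _ := trivial

include hL

theorem hasProducts : HasProducts.{u} L.FullSubcategory := fun J => by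
  have := hasLimits_of_lfp (K := K)
  have := hL.products J
  exact hasLimitsOfShape_of_closedUnderLimits _ L

theorem hasDirectedColimits : HasDirectedColimits L.FullSubcategory where
  hasColimitsOfShape J _ _ _ := by
    have := hL.directedColimits J
    exact hasColimitsOfShape_of_closedUnderColimits _ L

theorem preservesProductsAndDirectedColimits_ι : PreservesProductsAndDirectedColimits L.ι where
  products J := by
    have := hasLimits_of_lfp (K := K)
    have := hL.products J
    exact ⟨fun {D} => by
      have := createsLimitFullSubcategoryInclusion D (L.prop_limit _ fun j => (D.obj j).property)
      infer_instance⟩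
  directedColimits J _ _ _ := by
    have := hL.directedColimits J
    exact ⟨fun {D} => by
      have := createsColimitFullSubcategoryInclusion D
        (L.prop_colimit _ fun j => (D.obj j).property)
      infer_instance⟩

/-- The pure subobjects of the Löwenheim–Skolem presentation lie in `L`, so the whole diagram does,
and fullness reflects the colimit. -/
theorem exists_colimitPresentation : ∃ (κ : Cardinal.{u}) (_ : Fact κ.IsRegular),
    Cardinal.aleph0 ≤ κ ∧ ∀ X : L.FullSubcategory, ∃ (G : Type u) (_ : PartialOrder G)
      (_ : IsCardinalFiltered G κ) (D : G ⥤ L.FullSubcategory) (c : Cocone D) (_ : c.pt = X),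
      Nonempty (IsColimit c) ∧ Nonempty (IsColimit (L.ι.mapCocone c)) ∧
      ∀ g, IsCardinalPresentable (D.obj g).obj κ ∧ Mono (L.ι.map (c.ι.app g)) := by
  obtain ⟨κ, hκ', hκ, h⟩ := exists_pure_presentation (K := K)
  refine ⟨κ, hκ', hκ, fun X => ?_⟩
  obtain ⟨G, _, _, p, hp⟩ := h X.obj
  have hm : ∀ g, Mono (p.ι.app g) := fun g => mono_of_isPure _ (hp g).2
  let D : G ⥤ L.FullSubcategory := L.lift p.diag fun g =>
    hL.pureSubobjects (p.ι.app g) (hp g).2 X.property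
  let c : Cocone D :=
    { pt := X
      ι :=
        { app := fun g => ObjectProperty.homMk (p.ι.app g)
          naturality := fun g g' f => ObjectProperty.hom_ext _ (p.ι.naturality f) } }
  have hc : IsColimit (L.ι.mapCocone c) := p.isColimit
  exact ⟨G, _, ‹_›, D, c, rfl, ⟨isColimitOfReflects L.ι hc⟩, ⟨hc⟩, fun g => ⟨(hp g).1, hm g⟩⟩

attribute [local instance] Cardinal.fact_isRegular_aleph0 in
-- The test objects represent the `κ`-presentable objects of `K` that lie in `L`. Elements of an
-- interpretation, and morphisms from test objects, factor through a stage of a colimit of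
-- subobjects.
theorem exists_isTestFamily :
    ∃ (T : Type u) (N : T → L.FullSubcategory), IsTestFamily L.ι N := by
  obtain ⟨κ, _, hκ, h⟩ := hL.exists_colimitPresentation
  have : IsCardinalLocallyPresentable K κ := IsCardinalLocallyPresentable.of_le K hκ
  have : ObjectProperty.EssentiallySmall.{u} (isCardinalPresentable K κ ⊓ L) :=
    ObjectProperty.EssentiallySmall.of_le inf_le_left
  obtain ⟨T, S, hS, hS'⟩ := exists_small_family (isCardinalPresentable K κ ⊓ L)
  have hT : ∀ X : L.FullSubcategory, IsCardinalPresentable X.obj κ →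
      ∃ t, Nonempty (X ≅ ⟨S t, (hS t).2⟩) := fun X hX => by
    obtain ⟨t, ⟨e⟩⟩ := hS' X.obj ⟨hX, X.property⟩
    exact ⟨t, ⟨L.isoMk e⟩⟩
  refine ⟨T, fun t => ⟨S t, (hS t).2⟩, ⟨fun {F} hF X x => ?_, fun {X s t} f g => ?_⟩⟩
  · obtain ⟨G, _, _, D, c, rfl, ⟨hc⟩, -, hD⟩ := h X
    have : IsFiltered G := isFiltered_of_isCardinalFiltered G κ
    have : Nonempty G := IsFiltered.nonempty
    have : IsDirectedOrder G := ⟨fun i j => ⟨_, leOfHom (IsFiltered.leftToMax i j),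
      leOfHom (IsFiltered.rightToMax i j)⟩⟩
    obtain ⟨j, y, rfl⟩ := hF.exists_rep hc x
    obtain ⟨t, ⟨e⟩⟩ := hT (D.obj j) (hD j).1
    refine ⟨t, e.inv ≫ c.ι.app j, F.map e.hom y, ?_⟩
    rw [← comp_apply, ← Functor.map_comp, Iso.hom_inv_id_assoc]
  · obtain ⟨G, _, _, D, c, rfl, -, ⟨hc⟩, hD⟩ := h X
    have : IsFiltered G := isFiltered_of_isCardinalFiltered G κ
    have : ∀ t, IsCardinalPresentable (S t) κ := fun t => (hS t).1
    obtain ⟨i, f', hf⟩ := IsCardinalPresentable.exists_hom_of_isColimit κ hc (X := S s) f.hom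
    obtain ⟨j, g', hg⟩ := IsCardinalPresentable.exists_hom_of_isColimit κ hc (X := S t) g.hom
    obtain ⟨r, ⟨e⟩⟩ := hT (D.obj (IsFiltered.max i j)) (hD _).1
    have hm := (hD (IsFiltered.max i j)).2
    refine ⟨r, e.inv ≫ c.ι.app _,
      ObjectProperty.homMk f' ≫ D.map (IsFiltered.leftToMax i j) ≫ e.hom,
      ObjectProperty.homMk g' ≫ D.map (IsFiltered.rightToMax i j) ≫ e.hom, ?_, ?_, ?_⟩
    · rw [Functor.map_comp]
      infer_instance
    · simp only [Category.assoc, Iso.hom_inv_id_assoc, c.w]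
      exact ObjectProperty.hom_ext _ hf
    · simp only [Category.assoc, Iso.hom_inv_id_assoc, c.w]
      exact ObjectProperty.hom_ext _ hg

theorem essentiallySmall_plus : EssentiallySmall.{u} (Plus L.FullSubcategory) := by
  have := hL.hasProducts
  have := hL.hasDirectedColimits
  have := hL.preservesProductsAndDirectedColimits_ι
  obtain ⟨T, N, hN⟩ := hL.exists_isTestFamily
  exact hN.essentiallySmall

theorem preservesFiniteLimits_restriction : PreservesFiniteLimits (restriction hL) := by
  have : PreservesFiniteLimits (restriction hL ⋙ (IsInterpretation L.FullSubcategory).ι) := by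
    have : PreservesFiniteLimits ((Functor.whiskeringLeft _ _ (Type u)).obj L.ι) :=
      ⟨fun _ => inferInstance⟩
    exact inferInstanceAs (PreservesFiniteLimits ((IsInterpretation K).ι ⋙
      (Functor.whiskeringLeft _ _ _).obj L.ι))
  exact preservesFiniteLimits_of_reflects_of_preserves _ (IsInterpretation L.FullSubcategory).ι

/-- Pointwise surjectivity survives restriction to fewer objects. -/
theorem isRegularFunctor_restriction : IsRegularFunctor (restriction hL) where
  lex := hL.preservesFiniteLimits_restriction
  regularEpi _ _ f _ := Plus.isRegularEpi_of_surjective fun X =>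
    Plus.surjective_of_isRegularEpi f X.obj

/-- A cover by a restricted representable is a cover by an object in the image of `restriction hL`,
and by Yoneda the element `z` is a morphism of `Plus K`. -/
theorem isCovering_restriction : IsCovering (restriction hL) := by
  have := hL.hasProducts
  have := hL.hasDirectedColimits
  have := hL.preservesProductsAndDirectedColimits_ι
  obtain ⟨T, N, hN⟩ := hL.exists_isTestFamily
  refine ⟨fun F => ?_, fun {X W} i _ => ?_⟩
  · obtain ⟨C, hC, ν, hν⟩ := hN.exists_cover F
    exact ⟨⟨coyoneda.obj (op C), isInterpretation_coyoneda C⟩, ν,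
      Plus.isRegularEpi_of_surjective hν⟩
  · obtain ⟨C, hC, z, e, he, hz⟩ := hN.exists_cover_of_hom (X := X) i
    exact ⟨⟨coyoneda.obj (op C), isInterpretation_coyoneda C⟩,
      ObjectProperty.homMk
        { app := fun A => TypeCat.ofHom fun b : C ⟶ A => X.obj.map b z
          naturality := fun A B f => by
            ext b
            exact X.map_comp_apply b f z }, e, Plus.isRegularEpi_of_surjective he, hz⟩

end IsDefinable

theorem essentiallySmall_plus (K : Type w) [Category.{u} K] [IsLocallyFinitelyPresentable.{u} K] :
    EssentiallySmall.{u} (Plus K) := by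
  have : (⊤ : ObjectProperty K).ι.IsEquivalence :=
    { essSurj := ⟨fun X => ⟨⟨X, trivial⟩, ⟨Iso.refl _⟩⟩⟩ }
  have : ((Functor.whiskeringLeft _ _ (Type u)).obj (⊤ : ObjectProperty K).ι).IsEquivalence :=
    inferInstance
  have : (restriction (IsDefinable.top K)).Full :=
    inferInstanceAs (ObjectProperty.lift _ _ _).Full
  have : (restriction (IsDefinable.top K)).Faithful :=
    inferInstanceAs (ObjectProperty.lift _ _ _).Faithful
  have := (IsDefinable.top K).essentiallySmall_plus
  exact essentiallySmall_of_fully_faithful (restriction (IsDefinable.top K))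

end DefinableCat

/-! ### The epimorphism theorem -/

theorem corollary3p2p3 {K : Type w} [CategoryTheory.Category.{u} K]
    [CategoryTheory.IsLocallyFinitelyPresentable.{u} K]
    (L : CategoryTheory.ObjectProperty K) (hL : DefinableCat.IsDefinable L) :
    DefinableCat.IsEpiEX.{u, a, b} (DefinableCat.restriction hL) where
  source := ⟨DefinableCat.essentiallySmall_plus K, DefinableCat.Plus.isExact K⟩
  target := ⟨hL.essentiallySmall_plus, DefinableCat.Plus.isExact _⟩
  regular := hL.isRegularFunctor_restriction
  epi B _ _ P₁ P₂ hP₁ _ α := by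
    have := hL.preservesFiniteLimits_restriction
    have := (DefinableCat.Plus.isExact L.FullSubcategory).regular
    exact hL.isCovering_restriction.existsUnique_whiskerLeft_eq hP₁ P₂ α
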